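/- Let $p,q,r\ge 2$ be integers with $1/p+1/q+1/r<1$, and let the turnover $S(p,q,r)$ be the hyperbolic orbifold obtained by gluing two copies of a hyperbolic triangle with angles $\pi/p,\pi/q,\pi/r$ along their boundaries; its cone points, of orders $p,q,r$, are the three vertices. Let $S=\mathbb{H}^2/\Gamma$ be a closed hyperbolic surface (so necessarily of genus $g\ge 2$), where $\Gamma<PSL(2,\mathbb{R})$ is discrete and torsion-free with compact quotient. Suppose that there is a branched covering $S\to S(p,q,r)$ in the sense of hyperbolic orbifolds, i.e. a map which near each point $x$ is the quotient of a hyperbolic disc about $x$ by the rotation of order $n$ about $x$, where $n$ is the order of the image of $x$ if that is a cone point, and $n=1$ otherwise. Then $S$ is packable: there is a set of geodesic circles, each bounding an embedded closed disc in $S$, with pairwise disjoint interiors, whose packing graph triangulates $S$. Here the packing graph has the centres of the circles as vertices and, for each point at which two of the circles are tangent, one edge, namely the geodesic segment through that point joining the two centres. That it triangulates $S$ means that it is locally finite and embedded in $S$ and that every connected component of its complement is the interior of an embedded closed topological triangle whose corners are vertices and whose sides are edges of the graph (several edges may join the same two vertices). -/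

import Mathlib

open scoped UpperHalfPlane MatrixGroups

noncomputable section

namespace CirclePacking

/-! ### Geometry of the hyperbolic plane `ℍ` (upper half-plane with Mathlib's hyperbolic metric) -/

/-- The Cayley coordinate centred at `z`: a conformal map of `ℍ` onto the unit disc taking `z` to
`0`, the geodesics through `z` to the diameters, and the rotations about `z` to rotations
about `0`. -/
def cayley (z w : ℍ) : ℂ := ((w : ℂ) - z) / ((w : ℂ) - (starRingEnd ℂ) (z : ℂ))

/-- The angle at `z` between the geodesics from `z` to `a` and from `z` to `b`. -/
def hypAngle (a z b : ℍ) : ℝ := InnerProductGeometry.angle (cayley z a) (cayley z b)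

/-- The geodesic segment with endpoints `a` and `b`. -/
def hypSegment (a b : ℍ) : Set ℍ := {w | dist a w + dist w b = dist a b}

/-! ### Hyperbolic triangles and turnovers -/

/-- A hyperbolic triangle `ABC` with angle `π/p` at `A`, `π/q` at `B` and `π/r` at `C`. -/
structure HypTriangle (p q r : ℕ) where
  A : ℍ
  B : ℍ
  C : ℍ
  ne_AB : A ≠ B
  ne_BC : B ≠ C
  ne_CA : C ≠ A
  angle_A : hypAngle B A C = Real.pi / p
  angle_B : hypAngle C B A = Real.pi / q
  angle_C : hypAngle A C B = Real.pi / r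

namespace HypTriangle

variable {p q r : ℕ} (T : HypTriangle p q r)

/-- The closed triangular region: the union of the geodesic segments that join `A` to the points
of the opposite side `BC`. -/
def region : Set ℍ := {w | ∃ v ∈ hypSegment T.B T.C, w ∈ hypSegment T.A v}

/-- The boundary of the triangle: the union of its three sides. -/
def boundary : Set T.region :=
  {w | (w : ℍ) ∈ hypSegment T.A T.B ∪ hypSegment T.B T.C ∪ hypSegment T.C T.A}

theorem A_mem : T.A ∈ T.region := ⟨T.B, by simp [hypSegment], by simp [hypSegment]⟩

theorem B_mem : T.B ∈ T.region := ⟨T.B, by simp [hypSegment], by simp [hypSegment]⟩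

theorem C_mem : T.C ∈ T.region := ⟨T.C, by simp [hypSegment], by simp [hypSegment]⟩

instance : Nonempty T.boundary := ⟨⟨⟨T.A, T.A_mem⟩, by simp [boundary, hypSegment]⟩⟩

/-- The turnover `S(p,q,r)`: two copies of the triangle glued along their boundaries, with the
glued (path) metric. Points of one copy have their distance in `ℍ`; the distance of a point `x` of
one copy and a point `y` of the other is the infimum over boundary points `b` of
`dist x b + dist y b`. -/
def Turnover : Type :=
  Metric.GlueSpace (isometry_subtype_coe : Isometry ((↑) : T.boundary → T.region))
    (isometry_subtype_coe : Isometry ((↑) : T.boundary → T.region))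

instance : MetricSpace T.Turnover :=
  inferInstanceAs (MetricSpace (Metric.GlueSpace _ _))

/-- The first copy of the triangle in the turnover. -/
def front (x : T.region) : T.Turnover := Metric.toGlueL _ _ x

/-- The second copy of the triangle in the turnover. -/
def back (x : T.region) : T.Turnover := Metric.toGlueR _ _ x

open Classical in
/-- The order of the local group of the orbifold `S(p,q,r)` at a point: `p`, `q`, `r` at the three
cone points and `1` at every other point. -/
def coneOrder (y : T.Turnover) : ℕ :=
  if y = T.front ⟨T.A, T.A_mem⟩ then p
  else if y = T.front ⟨T.B, T.B_mem⟩ then q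
  else if y = T.front ⟨T.C, T.C_mem⟩ then r
  else 1

end HypTriangle

/-! ### Hyperbolic surfaces -/

/-- The group `PSL(2, ℝ)` of orientation-preserving isometries of `ℍ`. -/
abbrev PSL2R : Type := Matrix.ProjectiveSpecialLinearGroup (Fin 2) ℝ

/-- The preimage in `SL(2, ℝ)` of a subgroup of `PSL(2, ℝ)`. -/
def lift (Γ : Subgroup PSL2R) : Subgroup SL(2, ℝ) :=
  Γ.comap (QuotientGroup.mk' (Subgroup.center SL(2, ℝ)))

/-- The quotient space `ℍ / Γ` (with the quotient topology). -/
abbrev Surface (Γ : Subgroup PSL2R) : Type := MulAction.orbitRel.Quotient (lift Γ) ℍ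

/-- The quotient map `ℍ → ℍ / Γ`. -/
def proj (Γ : Subgroup PSL2R) (z : ℍ) : Surface Γ := Quotient.mk'' z

/-- `ℍ / Γ` is a closed hyperbolic surface: `Γ` is discrete and torsion-free and the quotient is
compact. -/
structure IsClosedHyperbolic (Γ : Subgroup PSL2R) : Prop where
  discrete : DiscreteTopology Γ
  torsionFree : ∀ γ ∈ Γ, IsOfFinOrder γ → γ = 1
  compact : CompactSpace (Surface Γ)

/-! ### Branched coverings of turnovers -/

/-- `f : ℍ / Γ → S(p,q,r)` is a (metric, orbifold) branched covering: near every point `proj z` it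
is the quotient of a hyperbolic disc about `z` by the rotation of order `n` about `z`, where `n` is
the order of the local group of `S(p,q,r)` at the image point. Precisely, for some `ε > 0` it maps
the `ε`-disc at `z` onto the `ε`-ball at the image point, and the distance of the images of `a` and
`b` is the least distance from `a` to a point `b'` obtained from `b` by rotating about `z` through
a multiple of `2π/n`, which in the Cayley coordinate at `z` means `(b')^n = b^n`. For `n = 1` this
is a local isometry, and at a cone point it is the `n`-fold branched cover `w ↦ w^n`. -/
def IsBranchedCover {Γ : Subgroup PSL2R} {p q r : ℕ} {T : HypTriangle p q r}
    (f : Surface Γ → T.Turnover) : Prop :=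
  ∀ z : ℍ, ∃ ε > 0,
    (fun w => f (proj Γ w)) '' Metric.ball z ε = Metric.ball (f (proj Γ z)) ε ∧
    ∀ a ∈ Metric.ball z ε, ∀ b ∈ Metric.ball z ε,
      IsLeast {d : ℝ | ∃ b' : ℍ, cayley z b' ^ T.coneOrder (f (proj Γ z)) =
          cayley z b ^ T.coneOrder (f (proj Γ z)) ∧ d = dist a b'}
        (dist (f (proj Γ a)) (f (proj Γ b)))

/-- `ℍ / Γ` is a branched cover of the turnover `S(p,q,r)`. -/
def CoversTurnover (Γ : Subgroup PSL2R) (p q r : ℕ) : Prop :=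
  ∃ (T : HypTriangle p q r) (f : Surface Γ → T.Turnover), IsBranchedCover f

/-! ### Triangulations -/

/-- The vertex set `V` and the edge set `E` form a graph embedded in `X` that triangulates `X`.
Several edges may join the same two vertices. -/
structure IsTriangulation {X : Type*} [TopologicalSpace X] (V : Set X) (E : Set (Set X)) :
    Prop where
  /-- every edge is an arc with endpoints in `V` that contains no further point of `V` -/
  edge_arc : ∀ e ∈ E, ∃ γ : unitInterval → X, Topology.IsEmbedding γ ∧ Set.range γ = e ∧
    ∀ t, γ t ∈ V ↔ t = 0 ∨ t = 1
  /-- distinct edges meet only at vertices -/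
  edge_inter : ∀ e ∈ E, ∀ e' ∈ E, e ≠ e' → e ∩ e' ⊆ V
  /-- the graph is locally finite -/
  locally_finite : ∀ x : X, ∃ U ∈ nhds x, (V ∩ U).Finite ∧ {e ∈ E | (e ∩ U).Nonempty}.Finite
  /-- every component of the complement of the graph is the interior of an embedded closed triangle
  whose corners are vertices and whose sides are edges -/
  face : ∀ x ∈ (V ∪ ⋃₀ E)ᶜ, ∃ σ : stdSimplex ℝ (Fin 3) → X, Topology.IsEmbedding σ ∧
    σ '' {t | ∀ i, 0 < t i} = connectedComponentIn (V ∪ ⋃₀ E)ᶜ x ∧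
    (∀ t : stdSimplex ℝ (Fin 3), (∃ i, t i = 1) → σ t ∈ V) ∧
    ∀ i : Fin 3, σ '' {t | t i = 0} ∈ E

/-! ### Circle packings -/

/-- A geodesic circle embedded in `ℍ / Γ`: the closed hyperbolic disc of the given radius about
any lift of the centre projects injectively to `ℍ / Γ`. -/
structure GeodesicCircle (Γ : Subgroup PSL2R) where
  center : Surface Γ
  radius : ℝ
  radius_pos : 0 < radius
  embedded : ∀ z : ℍ, proj Γ z = center → Set.InjOn (proj Γ) (Metric.closedBall z radius)

/-- The interior (open disc) of a geodesic circle. -/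
def GeodesicCircle.interior {Γ : Subgroup PSL2R} (c : GeodesicCircle Γ) : Set (Surface Γ) :=
  {s | ∃ z : ℍ, proj Γ z = c.center ∧ s ∈ proj Γ '' Metric.ball z c.radius}

/-- The vertices of the packing graph of a set of circles: their centres. -/
def packingVertices {Γ : Subgroup PSL2R} (P : Set (GeodesicCircle Γ)) : Set (Surface Γ) :=
  GeodesicCircle.center '' P

/-- The edges of the packing graph: for every point of tangency of two circles, the geodesic segment
through that point that joins their centres. Circles with disjoint interiors are tangent exactly
where lifts of them have centres `z`, `z'` at distance equal to the sum of the radii. -/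
def packingEdges {Γ : Subgroup PSL2R} (P : Set (GeodesicCircle Γ)) : Set (Set (Surface Γ)) :=
  {e | ∃ c ∈ P, ∃ c' ∈ P, c ≠ c' ∧ ∃ z z' : ℍ, proj Γ z = c.center ∧ proj Γ z' = c'.center ∧
    dist z z' = c.radius + c'.radius ∧ e = proj Γ '' hypSegment z z'}

/-- `ℍ / Γ` is packable: it carries a set of embedded geodesic circles with pairwise disjoint
interiors whose packing graph triangulates it. -/
def Packable (Γ : Subgroup PSL2R) : Prop :=
  ∃ P : Set (GeodesicCircle Γ),
    (∀ c ∈ P, ∀ c' ∈ P, c ≠ c' → Disjoint c.interior c'.interior) ∧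
    IsTriangulation (packingVertices P) (packingEdges P)

end CirclePacking

end

/-!
Let `A`, `B`, `C` be the vertices of the triangle `T`. The three circles about `A`, `B`, `C` whose
radii `triRadius` add up in pairs to the lengths of the sides are mutually tangent. Their preimages
under the branched covering `f` are the circles of the packing, and the packing graph is the
preimage of the triangulation of the turnover by its two sheets.

No tiling theorem for reflection groups is used: everything is lifted directly to
`F = f ∘ proj : ℍ → S(p,q,r)`.

* In the hyperboloid model `hyp`, geodesic segments and triangles are the nonnegative combinations
  of their vertices, three points in general position are a basis of `ℝ³`, a point is determined by
  its distances to them, and congruent triples are related by an isometry (`exists_isometryEquiv`).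
  The angle at `A` is needed only to see that `A`, `B`, `C` are in general position.
* Every point over a sheet lies on a lift `g` of that sheet, an isometry of `ℍ` with `F ∘ g` equal to
  the sheet on the whole triangle (`IsBranchedDevelopment.exists_lift`). Over an interior point `F`
  is a local isometry, which yields `g` locally; the identity `F ∘ g = sheet` then spreads over the
  connected open triangle (`isLift_of_eventually`) and to its closure. A boundary point is
  approached by interior ones, because `F` preserves distances to the centre of each small disc.
* `F` is `1`-Lipschitz, so circles over different cone points have disjoint interiors. Two circles
  over the same cone point are disjoint by `eq_of_dist_le`: near the midpoint of a shortest arc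
  between their centres both halves of the arc would map to the same radial segment of the turnover.
  With the triviality of stabilisers (`smul_eq_of_smul_eq`, from torsion-freeness) this also shows
  that the closed discs embed.
* Hence tangent circles lie over different cone points, the edges are the lifts of the sides
  (`mem_packingEdges_liftedCircles`), and the complementary components are the lifts of the open
  triangles (`connectedComponentIn_compl_graph`). Edges and faces are embedded because `f` is
  injective on them.
-/

namespace CirclePacking

/-! ### The hyperboloid model -/

/-- The Lorentzian form of signature `(1, 2)` polarising `v 0 * v 2 - v 1 ^ 2`. -/
noncomputable def mink : LinearMap.BilinForm ℝ (Fin 3 → ℝ) :=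
  LinearMap.mk₂ ℝ (fun v w => (v 0 * w 2 + v 2 * w 0) / 2 - v 1 * w 1)
    (fun _ _ _ => by simp only [Pi.add_apply]; ring)
    (fun _ _ _ => by simp only [Pi.smul_apply, smul_eq_mul]; ring)
    (fun _ _ _ => by simp only [Pi.add_apply]; ring)
    (fun _ _ _ => by simp only [Pi.smul_apply, smul_eq_mul]; ring)

theorem mink_apply (v w : Fin 3 → ℝ) :
    mink v w = (v 0 * w 2 + v 2 * w 0) / 2 - v 1 * w 1 := rfl

theorem mink_comm (v w : Fin 3 → ℝ) : mink v w = mink w v := by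
  simp only [mink_apply]; ring

/-- The point of the hyperboloid `mink v v = 1`, `0 < v 0`, that corresponds to `z`. -/
noncomputable def hyp (z : ℍ) : Fin 3 → ℝ :=
  ![1 / z.im, z.re / z.im, (z.re ^ 2 + z.im ^ 2) / z.im]

@[simp] theorem hyp_zero (z : ℍ) : hyp z 0 = 1 / z.im := rfl
@[simp] theorem hyp_one (z : ℍ) : hyp z 1 = z.re / z.im := rfl
@[simp] theorem hyp_two (z : ℍ) : hyp z 2 = (z.re ^ 2 + z.im ^ 2) / z.im := rfl

theorem mink_hyp (z w : ℍ) : mink (hyp z) (hyp w) = Real.cosh (dist z w) := by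
  have hz := z.im_ne_zero
  have hw := w.im_ne_zero
  rw [UpperHalfPlane.cosh_dist, mink_apply, Complex.dist_eq, ← Complex.normSq_eq_norm_sq,
    Complex.normSq_apply]
  simp
  field_simp
  ring

theorem mink_hyp_self (z : ℍ) : mink (hyp z) (hyp z) = 1 := by
  rw [mink_hyp]; simp

theorem hyp_injective : Function.Injective hyp := by
  intro z w h
  have h0 := congrFun h 0
  have h1 := congrFun h 1
  have hz := z.im_ne_zero
  have hw := w.im_ne_zero
  simp only [hyp_zero, hyp_one] at h0 h1
  have him : z.im = w.im := by
    field_simp at h0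
    exact h0.symm
  refine UpperHalfPlane.ext_re_im ?_ him
  rw [him] at h1
  field_simp at h1
  exact h1

theorem continuous_hyp : Continuous hyp := by
  have h1 := UpperHalfPlane.continuous_im
  have h2 := UpperHalfPlane.continuous_re
  refine continuous_pi fun i => ?_
  fin_cases i
  · exact continuous_const.div h1 fun z => z.im_ne_zero
  · exact h2.div h1 fun z => z.im_ne_zero
  · exact ((h2.pow 2).add (h1.pow 2)).div h1 fun z => z.im_ne_zero

theorem hyp_zero_pos (z : ℍ) : 0 < hyp z 0 := one_div_pos.2 z.im_pos

/-- The form is negative definite on the orthogonal complement of a point of the hyperboloid. -/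
theorem eq_zero_of_mink_hyp_eq_zero {v : Fin 3 → ℝ} {z : ℍ} (h : mink v (hyp z) = 0)
    (hv : 0 ≤ mink v v) : v = 0 := by
  have hy := z.im_pos
  rw [mink_apply] at h hv
  simp only [hyp_zero, hyp_one, hyp_two] at h
  field_simp at h
  have key : v 0 * v 2 - v 1 ^ 2 = -(v 0 * z.re - v 1) ^ 2 - (v 0 * z.im) ^ 2 := by
    linear_combination v 0 * h
  have h1 : (v 0 * z.im) ^ 2 = 0 := by
    nlinarith [sq_nonneg (v 0 * z.re - v 1), sq_nonneg (v 0 * z.im)]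
  have h2 : v 0 = 0 := by
    have := pow_eq_zero_iff (two_ne_zero) |>.1 h1
    exact (mul_eq_zero.1 this).resolve_right hy.ne'
  rw [h2] at key h
  have h3 : v 1 = 0 := by
    rw [h2] at hv
    nlinarith [sq_nonneg (v 1)]
  have h4 : v 2 = 0 := by rw [h3] at h; linarith
  ext i; fin_cases i <;> simp [h2, h3, h4]

/-- Equality case of the reversed Cauchy-Schwarz inequality on the hyperboloid. -/
theorem eq_hyp_of_mink {v : Fin 3 → ℝ} {z : ℍ} (h : mink v v = 1) (hz : mink v (hyp z) = 1) :
    v = hyp z := by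
  rw [← sub_eq_zero]
  apply eq_zero_of_mink_hyp_eq_zero (z := z)
  · rw [map_sub, LinearMap.sub_apply, hz, mink_hyp_self, sub_self]
  · simp only [map_sub, LinearMap.sub_apply]
    rw [mink_comm (hyp z) v, hz, h, mink_hyp_self]; norm_num

/-- A timelike vector with positive product with a point of the hyperboloid is future-directed. -/
theorem zero_lt_of_mink_pos {v : Fin 3 → ℝ} {z : ℍ} (h : 0 < mink v v)
    (hz : 0 < mink v (hyp z)) : 0 < v 0 := by
  have hy := z.im_pos
  rw [mink_apply] at h hz
  by_contra hn
  push Not at hn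
  have h1 : 0 < v 0 * (z.re ^ 2 + z.im ^ 2) + v 2 - 2 * v 1 * z.re := by
    have : 0 < 2 * z.im * ((v 0 * hyp z 2 + v 2 * hyp z 0) / 2 - v 1 * hyp z 1) := by positivity
    simp only [hyp_zero, hyp_one, hyp_two] at this
    field_simp at this
    linarith
  nlinarith [mul_nonneg_of_nonpos_of_nonpos hn hn, sq_nonneg (v 0 * z.re - v 1),
    mul_nonneg (neg_nonneg.2 hn) h1.le, sq_nonneg (v 0 * z.im)]

/-- The point of `ℍ` on the ray spanned by a vector `v` of `futureCone`; a junk value for other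
`v`. -/
noncomputable def unhyp (v : Fin 3 → ℝ) : ℍ :=
  UpperHalfPlane.ofComplex ⟨v 1 / v 0, √(mink v v) / v 0⟩

/-- The cone of future-directed timelike vectors. -/
def futureCone : Set (Fin 3 → ℝ) := {v | 0 < v 0 ∧ 0 < mink v v}

theorem hyp_unhyp {v : Fin 3 → ℝ} (hv : v ∈ futureCone) :
    hyp (unhyp v) = (√(mink v v))⁻¹ • v := by
  obtain ⟨h0, h1⟩ := hv
  have hs := Real.sqrt_pos.2 h1
  have hs2 := Real.sq_sqrt h1.le
  have him : 0 < (⟨v 1 / v 0, √(mink v v) / v 0⟩ : ℂ).im := div_pos hs h0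
  rw [unhyp, UpperHalfPlane.ofComplex_apply_of_im_pos him]
  set s := √(mink v v)
  rw [mink_apply] at hs2
  ext i
  fin_cases i
  · simp [div_eq_inv_mul]
  · simp
    field_simp
  · simp
    field_simp
    linear_combination hs2

theorem unhyp_eq {v : Fin 3 → ℝ} {z : ℍ} {c : ℝ} (hc : 0 < c) (h : v = c • hyp z) :
    unhyp v = z := by
  have hm : mink v v = c ^ 2 := by
    rw [h]; simp [mink_hyp_self]; ring
  have hv : v ∈ futureCone := by
    refine ⟨?_, by rw [hm]; positivity⟩
    rw [h]; exact mul_pos hc (hyp_zero_pos z)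
  apply hyp_injective
  rw [hyp_unhyp hv, hm, Real.sqrt_sq hc.le, h, smul_smul, inv_mul_cancel₀ hc.ne', one_smul]

theorem unhyp_hyp (z : ℍ) : unhyp (hyp z) = z := unhyp_eq one_pos (one_smul _ _).symm

theorem hyp_unhyp_of_mink_eq_one {v : Fin 3 → ℝ} (h0 : 0 < v 0) (h : mink v v = 1) :
    hyp (unhyp v) = v := by
  rw [hyp_unhyp ⟨h0, by rw [h]; norm_num⟩, h]; simp

theorem continuous_mink_self : Continuous fun v : Fin 3 → ℝ => mink v v := by
  simp only [mink_apply]; fun_prop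

theorem continuousOn_unhyp : ContinuousOn unhyp futureCone := by
  intro v hv
  have him : 0 < (⟨v 1 / v 0, √(mink v v) / v 0⟩ : ℂ).im :=
    div_pos (Real.sqrt_pos.2 hv.2) hv.1
  apply ContinuousAt.continuousWithinAt
  have h1 : ContinuousAt (fun v : Fin 3 → ℝ => (⟨v 1 / v 0, √(mink v v) / v 0⟩ : ℂ)) v := by
    have : (fun v : Fin 3 → ℝ => (⟨v 1 / v 0, √(mink v v) / v 0⟩ : ℂ)) =
        fun v => ((v 1 / v 0 : ℝ) : ℂ) + ((√(mink v v) / v 0 : ℝ) : ℂ) * Complex.I := by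
      ext v; apply Complex.ext <;> simp
    rw [this]
    have hc := continuous_mink_self.continuousAt (x := v)
    have h2 : ContinuousAt (fun v : Fin 3 → ℝ => v 1 / v 0) v :=
      ContinuousAt.div (continuous_apply _).continuousAt (continuous_apply _).continuousAt hv.1.ne'
    have h3 : ContinuousAt (fun v : Fin 3 → ℝ => √(mink v v) / v 0) v :=
      ContinuousAt.div hc.sqrt (continuous_apply _).continuousAt hv.1.ne'
    exact (Complex.continuous_ofReal.continuousAt.comp h2).add
      ((Complex.continuous_ofReal.continuousAt.comp h3).mul continuousAt_const)
  exact ContinuousAt.comp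
    (g := UpperHalfPlane.ofComplex)
    (UpperHalfPlane.contMDiffAt_ofComplex (n := 0) him).continuousAt h1

/-! ### Geodesic segments -/

/-- The sine law of subdivision: a point of the segment `ab` is the combination of `a` and `b` in
the hyperboloid model whose weights are the `sinh` of the opposite parts. -/
theorem sinh_smul_hyp {a b w : ℍ} (h : w ∈ hypSegment a b) :
    Real.sinh (dist a b) • hyp w =
      Real.sinh (dist w b) • hyp a + Real.sinh (dist a w) • hyp b := by
  rcases eq_or_ne a b with rfl | hab
  · have : dist a w = 0 := by
      have : dist a w + dist w a = dist a a := h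
      rw [dist_comm w a, dist_self] at this
      linarith
    rw [dist_comm w a, this]; simp
  have hd : 0 < Real.sinh (dist a b) := Real.sinh_pos_iff.2 (dist_pos.2 hab)
  have h' : dist a w + dist w b = dist a b := h
  set d := dist a b
  set x := dist a w with hx
  set y := dist w b with hy
  set v := (Real.sinh d)⁻¹ • (Real.sinh y • hyp a + Real.sinh x • hyp b) with hvdef
  have hc : Real.cosh d = Real.cosh x * Real.cosh y + Real.sinh x * Real.sinh y := by
    rw [← h', Real.cosh_add]
  have hs : Real.sinh d = Real.sinh x * Real.cosh y + Real.cosh x * Real.sinh y := by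
    rw [← h', Real.sinh_add]
  have e1 : v = hyp w := by
    apply eq_hyp_of_mink
    · simp only [hvdef, map_add, map_smul, LinearMap.add_apply, LinearMap.smul_apply, smul_eq_mul,
        mink_hyp, dist_self, Real.cosh_zero, dist_comm b a]
      change (Real.sinh d)⁻¹ * (Real.sinh y * ((Real.sinh d)⁻¹ * (Real.sinh y * 1 +
        Real.sinh x * Real.cosh d)) + Real.sinh x * ((Real.sinh d)⁻¹ *
        (Real.sinh y * Real.cosh d + Real.sinh x * 1))) = 1
      field_simp
      rw [hc, hs]
      have := Real.cosh_sq x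
      have := Real.cosh_sq y
      grind
    · simp only [hvdef, map_add, map_smul, LinearMap.add_apply, LinearMap.smul_apply, smul_eq_mul,
        mink_hyp, dist_comm b w]
      rw [← hx, ← hy]
      field_simp
      rw [hs]; ring
  rw [← e1, hvdef, smul_smul, mul_inv_cancel₀ hd.ne', one_smul]

/-- In the hyperboloid model the points of the segment `ab` are the nonnegative combinations of
`a` and `b`. -/
theorem mem_hypSegment_iff {a b w : ℍ} :
    w ∈ hypSegment a b ↔ ∃ α β : ℝ, 0 ≤ α ∧ 0 ≤ β ∧ hyp w = α • hyp a + β • hyp b := by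
  constructor
  · intro h
    rcases eq_or_ne a b with rfl | hab
    · refine ⟨1, 0, by simp, by simp, ?_⟩
      have : dist a w = 0 := by
        have : dist a w + dist w a = dist a a := h
        rw [dist_comm w a, dist_self] at this
        linarith
      rw [dist_eq_zero] at this
      simp [this]
    · have hd : 0 < Real.sinh (dist a b) := Real.sinh_pos_iff.2 (dist_pos.2 hab)
      refine ⟨(Real.sinh (dist a b))⁻¹ * Real.sinh (dist w b),
        (Real.sinh (dist a b))⁻¹ * Real.sinh (dist a w),
        mul_nonneg (inv_nonneg.2 hd.le) (Real.sinh_nonneg_iff.2 dist_nonneg),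
        mul_nonneg (inv_nonneg.2 hd.le) (Real.sinh_nonneg_iff.2 dist_nonneg), ?_⟩
      rw [← smul_smul, ← smul_smul, ← smul_add, ← sinh_smul_hyp h, smul_smul,
        inv_mul_cancel₀ hd.ne', one_smul]
  · rintro ⟨α, β, hα, hβ, h⟩
    have hx : Real.cosh (dist a w) = α + β * Real.cosh (dist a b) := by
      rw [← mink_hyp, h]; simp [mink_hyp]
    have hy : Real.cosh (dist w b) = α * Real.cosh (dist a b) + β := by
      rw [← mink_hyp, h]; simp [mink_hyp]
    have h1 : α ^ 2 + β ^ 2 + 2 * α * β * Real.cosh (dist a b) = 1 := by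
      rw [← mink_hyp_self w, h]; simp [mink_hyp, dist_comm b a]; ring
    have hC := Real.cosh_sq (dist a b)
    have hsx : Real.sinh (dist a w) = β * Real.sinh (dist a b) := by
      have h0 : 0 ≤ Real.sinh (dist a w) := Real.sinh_nonneg_iff.2 dist_nonneg
      have h0' : 0 ≤ β * Real.sinh (dist a b) :=
        mul_nonneg hβ (Real.sinh_nonneg_iff.2 dist_nonneg)
      rw [← sq_eq_sq₀ h0 h0']
      have := Real.cosh_sq (dist a w)
      rw [hx] at this
      nlinarith
    have hsy : Real.sinh (dist w b) = α * Real.sinh (dist a b) := by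
      have h0 : 0 ≤ Real.sinh (dist w b) := Real.sinh_nonneg_iff.2 dist_nonneg
      have h0' : 0 ≤ α * Real.sinh (dist a b) :=
        mul_nonneg hα (Real.sinh_nonneg_iff.2 dist_nonneg)
      rw [← sq_eq_sq₀ h0 h0']
      have := Real.cosh_sq (dist w b)
      rw [hy] at this
      nlinarith
    have : Real.cosh (dist a w + dist w b) = Real.cosh (dist a b) := by
      rw [Real.cosh_add, hx, hy, hsx, hsy]
      linear_combination Real.cosh (dist a b) * h1 - α * β * hC
    have := Real.cosh_injOn (by simp; positivity) (by simp) this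
    exact this

theorem hypSegment_comm (a b : ℍ) : hypSegment a b = hypSegment b a := by
  ext w
  simp only [hypSegment, Set.mem_ofPred_eq, dist_comm a b, dist_comm a w, dist_comm w b]
  rw [add_comm]

theorem eq_of_mem_hypSegment {a b w w' : ℍ} (h : w ∈ hypSegment a b) (h' : w' ∈ hypSegment a b)
    (hd : dist a w = dist a w') : w = w' := by
  rcases eq_or_ne a b with rfl | hab
  · have e : dist a w + dist w a = dist a a := h
    have e' : dist a w' + dist w' a = dist a a := h'
    rw [dist_comm w a, dist_self] at e
    rw [dist_comm w' a, dist_self] at e'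
    rw [← dist_le_zero.1 (by linarith : dist a w ≤ 0), dist_le_zero.1 (by linarith : dist a w' ≤ 0)]
  have hs : Real.sinh (dist a b) ≠ 0 := (Real.sinh_pos_iff.2 (dist_pos.2 hab)).ne'
  have e : dist a w + dist w b = dist a b := h
  have e' : dist a w' + dist w' b = dist a b := h'
  apply hyp_injective
  apply smul_right_injective _ hs
  change Real.sinh (dist a b) • hyp w = Real.sinh (dist a b) • hyp w'
  rw [sinh_smul_hyp h, sinh_smul_hyp h', hd, (by linarith : dist w b = dist w' b)]

/-- A geodesic arc has only one extension of given length beyond an endpoint. -/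
theorem eq_of_mem_hypSegment_of_ne {a a' m p : ℍ} (h : m ∈ hypSegment a p)
    (h' : m ∈ hypSegment a' p) (hd : dist a m = dist a' m) (hm : m ≠ p) : a = a' := by
  have e : dist a m + dist m p = dist a p := h
  have e' : dist a' m + dist m p = dist a' p := h'
  have hs : Real.sinh (dist m p) ≠ 0 := (Real.sinh_pos_iff.2 (dist_pos.2 hm)).ne'
  apply hyp_injective
  apply smul_right_injective _ hs
  have h1 := sinh_smul_hyp h
  have h2 := sinh_smul_hyp h'
  change Real.sinh (dist m p) • hyp a = Real.sinh (dist m p) • hyp a'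
  rw [← e] at h1
  rw [← e', ← hd] at h2
  exact add_right_cancel (h1.symm.trans h2)

/-- Any two distinct points lie on a geodesic line parametrised by arc length. -/
theorem exists_geodesic {a b : ℍ} (hab : a ≠ b) :
    ∃ γ : ℝ → ℍ, Isometry γ ∧ γ 0 = a ∧ γ (dist a b) = b := by
  have hs := Real.sinh_pos_iff.2 (dist_pos.2 hab)
  set d := dist a b with hd
  set e : Fin 3 → ℝ := (Real.sinh d)⁻¹ • (hyp b - Real.cosh d • hyp a) with he
  have hea : mink e (hyp a) = 0 := by
    simp [he, mink_hyp, dist_comm b a, ← hd]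
  have hee : mink e e = -1 := by
    simp only [he, map_sub, map_smul, LinearMap.sub_apply, LinearMap.smul_apply, smul_eq_mul,
        mink_hyp, dist_comm b a, ← hd, dist_self, Real.cosh_zero]
    field_simp
    have := Real.cosh_sq d
    linarith
  have hae : mink (hyp a) e = 0 := by rw [mink_comm, hea]
  let v : ℝ → Fin 3 → ℝ := fun t => Real.cosh t • hyp a + Real.sinh t • e
  have hv : ∀ s t, mink (v s) (v t) = Real.cosh (s - t) := by
    intro s t
    simp only [v, map_add, map_smul, LinearMap.add_apply, LinearMap.smul_apply, smul_eq_mul,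
      hea, hae, hee, mink_hyp_self, Real.cosh_sub]
    ring
  have hv1 : ∀ t, mink (v t) (v t) = 1 := fun t => by rw [hv]; simp
  have hv0 : v 0 = hyp a := by simp [v]
  have hvp : ∀ t, 0 < v t 0 := fun t => by
    apply zero_lt_of_mink_pos (z := a)
    · rw [hv1]; norm_num
    · rw [← hv0, hv]; exact Real.cosh_pos _
  have hvd : v d = hyp b := by
    simp only [v, he, smul_smul, mul_inv_cancel₀ hs.ne', one_smul]
    abel
  refine ⟨fun t => unhyp (v t), Isometry.of_dist_eq fun s t => ?_, ?_, ?_⟩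
  · have : Real.cosh (dist (unhyp (v s)) (unhyp (v t))) = Real.cosh (dist s t) := by
      rw [← mink_hyp, hyp_unhyp_of_mink_eq_one (hvp s) (hv1 s),
        hyp_unhyp_of_mink_eq_one (hvp t) (hv1 t), hv, Real.dist_eq, Real.cosh_abs]
    exact Real.cosh_injOn (by simp) (by simp) this
  · simp only [hv0, unhyp_hyp]
  · simp only [hvd, unhyp_hyp]

/-! ### Points in general position and extension of isometries -/

/-- Every nonempty open set contains three points in general position: a point and small
horizontal and vertical translates of it. -/
theorem exists_linearIndependent_hyp {N : Set ℍ} (hN : IsOpen N) (hne : N.Nonempty) :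
    ∃ a : Fin 3 → ℍ, (∀ i, a i ∈ N) ∧ LinearIndependent ℝ fun i => hyp (a i) := by
  obtain ⟨z, hz⟩ := hne
  have hy := z.im_pos
  let f : ℝ → ℍ := fun δ => ⟨(z : ℂ) + (|δ| : ℝ), by simpa using hy⟩
  let g : ℝ → ℍ := fun δ => ⟨(z : ℂ) + (|δ| : ℝ) * Complex.I, by simp; positivity⟩
  have hf : Continuous f := by
    apply Continuous.upperHalfPlaneMk; fun_prop
  have hg : Continuous g := by
    apply Continuous.upperHalfPlaneMk; fun_prop
  have hf0 : f 0 = z := by apply UpperHalfPlane.ext; simp [f]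
  have hg0 : g 0 = z := by apply UpperHalfPlane.ext; simp [g]
  have h1 : ∀ᶠ δ in nhds (0 : ℝ), f δ ∈ N :=
    hf.continuousAt.eventually_mem (by rw [hf0]; exact hN.mem_nhds hz)
  have h2 : ∀ᶠ δ in nhds (0 : ℝ), g δ ∈ N :=
    hg.continuousAt.eventually_mem (by rw [hg0]; exact hN.mem_nhds hz)
  obtain ⟨ε, hε, h⟩ := Metric.eventually_nhds_iff.1 (h1.and h2)
  have hδ : dist (ε / 2) 0 < ε := by
    rw [Real.dist_eq, sub_zero, abs_of_pos (by positivity)]; linarith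
  obtain ⟨m1, m2⟩ := h hδ
  refine ⟨![z, f (ε / 2), g (ε / 2)], ?_, ?_⟩
  · intro i; fin_cases i
    exacts [hz, m1, m2]
  · rw [Fintype.linearIndependent_iff]
    intro c hc
    simp only [Fin.sum_univ_three] at hc
    set δ := ε / 2 with hδdef
    have hδ0 : 0 < δ := by positivity
    have fr : (f δ).re = z.re + δ := by simp [f, abs_of_pos hδ0]
    have fi : (f δ).im = z.im := by simp [f]
    have gr : (g δ).re = z.re := by simp [g]
    have gi : (g δ).im = z.im + δ := by simp [g, abs_of_pos hδ0]
    have e0 := congrFun hc 0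
    have e1 := congrFun hc 1
    have e2 := congrFun hc 2
    simp [fr, fi, gr, gi] at e0 e1 e2
    have hyd : z.im + δ ≠ 0 := by positivity
    have hy' := hy.ne'
    field_simp at e0 e1 e2
    have k1 : c 1 = 0 := by
      have : c 1 * (δ * (z.im + δ)) = 0 := by linear_combination e1 - z.re * e0
      exact (mul_eq_zero.1 this).resolve_right (by positivity)
    rw [k1] at e0 e2
    have k2 : c 2 = 0 := by
      have : c 2 * (z.im * δ * (2 * z.im + δ)) = 0 := by
        linear_combination e2 - (z.re ^ 2 + z.im ^ 2) * e0
      exact (mul_eq_zero.1 this).resolve_right (by positivity)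
    have k0 : c 0 = 0 := by
      rw [k2] at e0
      have : c 0 * (z.im + δ) = 0 := by linear_combination e0
      exact (mul_eq_zero.1 this).resolve_right hyd
    intro i; fin_cases i
    exacts [k0, k1, k2]

theorem eq_zero_of_mink {v : Fin 3 → ℝ} (h : ∀ w, mink v w = 0) : v = 0 := by
  have h0 := h ![1, 0, 0]
  have h1 := h ![0, 1, 0]
  have h2 := h ![0, 0, 1]
  simp [mink_apply] at h0 h1 h2
  ext i; fin_cases i
  exacts [h2, h1, h0]

/-- The basis of `ℝ³` given by three points of `ℍ` in general position. -/
noncomputable def hypBasis {a : Fin 3 → ℍ} (ha : LinearIndependent ℝ fun i => hyp (a i)) :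
    Module.Basis (Fin 3) ℝ (Fin 3 → ℝ) :=
  basisOfLinearIndependentOfCardEqFinrank ha (by simp)

@[simp] theorem hypBasis_apply {a : Fin 3 → ℍ} (ha : LinearIndependent ℝ fun i => hyp (a i))
    (i : Fin 3) : hypBasis ha i = hyp (a i) := by simp [hypBasis]

/-- A point is determined by its distances to three points in general position. -/
theorem eq_of_dist_eq {a : Fin 3 → ℍ} (ha : LinearIndependent ℝ fun i => hyp (a i)) {b b' : ℍ}
    (h : ∀ i, dist b (a i) = dist b' (a i)) : b = b' := by
  apply hyp_injective
  rw [← sub_eq_zero]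
  apply eq_zero_of_mink
  have : mink (hyp b - hyp b') = 0 := by
    apply (hypBasis ha).ext
    intro i
    simp [mink_hyp, h i]
  intro w; rw [this]; simp

/-- Two congruent triples, the first in general position, are matched by an isometry of `ℍ`. -/
theorem exists_isometryEquiv {a w : Fin 3 → ℍ} (ha : LinearIndependent ℝ fun i => hyp (a i))
    (h : ∀ i j, dist (a i) (a j) = dist (w i) (w j)) : ∃ g : ℍ ≃ᵢ ℍ, ∀ i, g (a i) = w i := by
  let L : (Fin 3 → ℝ) →ₗ[ℝ] (Fin 3 → ℝ) := (hypBasis ha).constr ℝ fun i => hyp (w i)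
  have hL : ∀ i, L (hyp (a i)) = hyp (w i) := fun i => by
    have := (hypBasis ha).constr_basis ℝ (fun i => hyp (w i)) i
    rwa [hypBasis_apply] at this
  have hpres : ∀ u v, mink (L u) (L v) = mink u v := by
    have : mink.compl₁₂ L L = mink := by
      apply (hypBasis ha).ext
      intro i
      apply (hypBasis ha).ext
      intro j
      simp [hL, mink_hyp, h]
    intro u v
    exact LinearMap.congr_fun (LinearMap.congr_fun this u) v
  have hinj : Function.Injective L := by
    rw [injective_iff_map_eq_zero]
    intro v hv
    apply eq_zero_of_mink
    intro u
    rw [← hpres, hv]; simp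
  have hsurj : Function.Surjective L := LinearMap.surjective_of_injective hinj
  have hpos : ∀ v, mink v v = 1 → (0 < mink (L v) (hyp (w 0)) ↔ 0 < mink v (hyp (a 0))) := by
    intro v _
    rw [← hL, hpres]
  have hLz : ∀ z, 0 < L (hyp z) 0 ∧ mink (L (hyp z)) (L (hyp z)) = 1 := by
    intro z
    have h1 : mink (L (hyp z)) (L (hyp z)) = 1 := by rw [hpres, mink_hyp_self]
    refine ⟨zero_lt_of_mink_pos (z := w 0) (by rw [h1]; norm_num) ?_, h1⟩
    rw [hpos _ (mink_hyp_self z), mink_hyp]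
    exact Real.cosh_pos _
  let g : ℍ → ℍ := fun z => unhyp (L (hyp z))
  have hg : ∀ z, hyp (g z) = L (hyp z) := fun z =>
    hyp_unhyp_of_mink_eq_one (hLz z).1 (hLz z).2
  have hiso : Isometry g := by
    apply Isometry.of_dist_eq
    intro x y
    have : Real.cosh (dist (g x) (g y)) = Real.cosh (dist x y) := by
      rw [← mink_hyp, ← mink_hyp, hg, hg, hpres]
    exact Real.cosh_injOn (by simp) (by simp) this
  have hgs : Function.Surjective g := by
    intro c
    obtain ⟨v, hv⟩ := hsurj (hyp c)
    have h1 : mink v v = 1 := by rw [← hpres, hv, mink_hyp_self]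
    have h0 : 0 < v 0 := by
      apply zero_lt_of_mink_pos (z := a 0) (by rw [h1]; norm_num)
      rw [← hpos v h1, hv, mink_hyp]; exact Real.cosh_pos _
    refine ⟨unhyp v, ?_⟩
    apply hyp_injective
    rw [hg, hyp_unhyp_of_mink_eq_one h0 h1, hv]
  refine ⟨⟨Equiv.ofBijective g ⟨hiso.injective, hgs⟩, hiso⟩, fun i => ?_⟩
  change g (a i) = w i
  apply hyp_injective
  rw [hg, hL]

/-! ### Triangles in barycentric coordinates -/

section Triangle

variable {a : Fin 3 → ℍ} (ha : LinearIndependent ℝ fun i => hyp (a i))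

/-- The `i`-th (unnormalised) barycentric coordinate with respect to the triangle `a`: the
coefficient of `hyp (a i)` in the expansion of `hyp z`. -/
noncomputable def bary (i : Fin 3) (z : ℍ) : ℝ := (hypBasis ha).repr (hyp z) i

/-- The closed triangle with vertices `a`. -/
def closedTri : Set ℍ := {z | ∀ i, 0 ≤ bary ha i z}

/-- The open triangle with vertices `a`. -/
def openTri : Set ℍ := {z | ∀ i, 0 < bary ha i z}

theorem sum_bary (z : ℍ) : ∑ i, bary ha i z • hyp (a i) = hyp z := by
  have := (hypBasis ha).sum_repr (hyp z)
  simpa only [hypBasis_apply, bary] using this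

theorem bary_eq {z : ℍ} {c : Fin 3 → ℝ} (h : hyp z = ∑ i, c i • hyp (a i)) (i : Fin 3) :
    bary ha i z = c i := by
  have : hyp z = ∑ i, c i • hypBasis ha i := by simpa using h
  rw [bary, this, Module.Basis.repr_sum_self]

theorem bary_vertex (i j : Fin 3) : bary ha i (a j) = if i = j then 1 else 0 := by
  apply bary_eq ha (c := fun i => if i = j then 1 else 0)
  simp

theorem continuous_bary (i : Fin 3) : Continuous (bary ha i) := by
  have : Continuous fun v : Fin 3 → ℝ => (hypBasis ha).coord i v :=
    LinearMap.continuous_of_finiteDimensional _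
  exact this.comp continuous_hyp

theorem isOpen_openTri : IsOpen (openTri ha) := by
  have : openTri ha = ⋂ i, {z | 0 < bary ha i z} := by ext z; simp [openTri]
  rw [this]
  exact isOpen_iInter_of_finite fun i => isOpen_lt continuous_const (continuous_bary ha i)

theorem openTri_subset_closedTri : openTri ha ⊆ closedTri ha := fun _ h i => (h i).le

theorem vertex_mem_closedTri (j : Fin 3) : a j ∈ closedTri ha := by
  intro i; rw [bary_vertex]; split_ifs <;> norm_num

theorem sum_mem_futureCone (a : Fin 3 → ℍ) {c : Fin 3 → ℝ} (hc : ∀ i, 0 ≤ c i)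
    (h : ∃ i, 0 < c i) : ∑ i, c i • hyp (a i) ∈ futureCone := by
  obtain ⟨k, hk⟩ := h
  constructor
  · simp only [Finset.sum_apply, Pi.smul_apply, smul_eq_mul]
    exact Finset.sum_pos' (fun i _ => mul_nonneg (hc i) (hyp_zero_pos _).le)
      ⟨k, Finset.mem_univ _, mul_pos hk (hyp_zero_pos _)⟩
  · simp only [map_sum, map_smul, LinearMap.sum_apply, LinearMap.smul_apply, smul_eq_mul, mink_hyp]
    have hnn : ∀ i j, 0 ≤ c i * (c j * Real.cosh (dist (a j) (a i))) := fun i j =>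
      mul_nonneg (hc i) (mul_nonneg (hc j) (Real.cosh_pos _).le)
    refine Finset.sum_pos' (fun i _ => mul_nonneg (hc i) (Finset.sum_nonneg fun j _ =>
      mul_nonneg (hc j) (Real.cosh_pos _).le)) ⟨k, Finset.mem_univ _, ?_⟩
    refine mul_pos hk (Finset.sum_pos' (fun j _ => mul_nonneg (hc j) (Real.cosh_pos _).le)
      ⟨k, Finset.mem_univ _, mul_pos hk (Real.cosh_pos _)⟩)

/-- The point of `ℍ` with barycentric coordinates proportional to `c`, which should be nonnegative
and not all zero. -/
noncomputable def baryPoint (a : Fin 3 → ℍ) (c : Fin 3 → ℝ) : ℍ := unhyp (∑ i, c i • hyp (a i))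

theorem exists_bary_baryPoint {c : Fin 3 → ℝ} (hc : ∀ i, 0 ≤ c i) (h : ∃ i, 0 < c i) :
    ∃ l : ℝ, 0 < l ∧ ∀ i, bary ha i (baryPoint a c) = l * c i := by
  have hm := sum_mem_futureCone a hc h
  refine ⟨(√(mink (∑ i, c i • hyp (a i)) (∑ i, c i • hyp (a i))))⁻¹,
    inv_pos.2 (Real.sqrt_pos.2 hm.2), fun i => ?_⟩
  apply bary_eq ha (c := fun i => _ * c i)
  rw [baryPoint, hyp_unhyp hm, Finset.smul_sum]
  simp only [smul_smul]

theorem baryPoint_bary (z : ℍ) : baryPoint a (fun i => bary ha i z) = z := by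
  rw [baryPoint, sum_bary, unhyp_hyp]

theorem continuousOn_baryPoint (a : Fin 3 → ℍ) :
    ContinuousOn (baryPoint a) {c | (∀ i, 0 ≤ c i) ∧ ∃ i, 0 < c i} := by
  apply continuousOn_unhyp.comp
  · exact Continuous.continuousOn (by fun_prop)
  · rintro c ⟨hc, h⟩
    exact sum_mem_futureCone a hc h

theorem openTri_eq_image : openTri ha = baryPoint a '' {c | ∀ i, 0 < c i} := by
  ext z
  constructor
  · intro hz
    exact ⟨_, hz, baryPoint_bary ha z⟩
  · rintro ⟨c, hc, rfl⟩ i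
    obtain ⟨l, hl, h⟩ := exists_bary_baryPoint ha (fun i => (hc i).le) ⟨0, hc 0⟩
    rw [h]; exact mul_pos hl (hc i)

theorem isPreconnected_openTri : IsPreconnected (openTri ha) := by
  rw [openTri_eq_image]
  refine IsPreconnected.image ?_ _ ((continuousOn_baryPoint a).mono fun c hc =>
    ⟨fun i => (hc i).le, 0, hc 0⟩)
  apply Convex.isPreconnected
  have : {c : Fin 3 → ℝ | ∀ i, 0 < c i} = Set.univ.pi fun _ => Set.Ioi 0 := by ext; simp
  rw [this]
  exact convex_pi fun _ _ => convex_Ioi _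

theorem closedTri_subset_closure : closedTri ha ⊆ closure (openTri ha) := by
  intro z hz
  let c : ℝ → Fin 3 → ℝ := fun t i => bary ha i z + t
  have hc0 : c 0 = fun i => bary ha i z := by ext i; simp [c]
  have hzpos : ∃ i, 0 < bary ha i z := by
    by_contra hn
    push Not at hn
    have h0 : ∀ i, bary ha i z = 0 := fun i => le_antisymm (hn i) (hz i)
    have := sum_bary ha z
    simp only [h0, zero_smul, Finset.sum_const_zero] at this
    have h1 := hyp_zero_pos z
    rw [← this] at h1
    simp at h1
  have hcont : ContinuousWithinAt (fun t => baryPoint a (c t)) (Set.Ioi 0) 0 := by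
    have hc : Continuous c := continuous_pi fun i => continuous_const.add continuous_id
    have hm : c 0 ∈ {c : Fin 3 → ℝ | (∀ i, 0 ≤ c i) ∧ ∃ i, 0 < c i} := by
      rw [hc0]; exact ⟨hz, hzpos⟩
    refine (continuousOn_baryPoint a (c 0) hm).comp hc.continuousWithinAt fun t ht => ?_
    have ht' : 0 < t := ht
    exact ⟨fun i => add_nonneg (hz i) ht'.le, 0, add_pos_of_nonneg_of_pos (hz 0) ht'⟩
  have h0 : baryPoint a (c 0) = z := by
    rw [hc0]; exact baryPoint_bary ha z
  have ht : Filter.Tendsto (fun t => baryPoint a (c t)) (nhdsWithin 0 (Set.Ioi 0)) (nhds z) := by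
    have := hcont.tendsto
    rwa [h0] at this
  refine mem_closure_of_tendsto ht ?_
  filter_upwards [self_mem_nhdsWithin] with t ht
  rw [openTri_eq_image]
  have ht' : 0 < t := ht
  exact ⟨c t, fun i => add_pos_of_nonneg_of_pos (hz i) ht', rfl⟩

/-- The side between two vertices is where the third barycentric coordinate vanishes. -/
theorem mem_hypSegment_vertices_iff {i j : Fin 3} (hij : i ≠ j) {z : ℍ} :
    z ∈ hypSegment (a i) (a j) ↔
      z ∈ closedTri ha ∧ ∀ k, k ≠ i → k ≠ j → bary ha k z = 0 := by
  rw [mem_hypSegment_iff]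
  constructor
  · rintro ⟨α, β, hα, hβ, h⟩
    have hb : ∀ k, bary ha k z = if k = i then α else if k = j then β else 0 := by
      apply bary_eq ha (c := fun k => if k = i then α else if k = j then β else 0)
      rw [h, Finset.sum_eq_add i j hij]
      · simp [hij.symm]
      · rintro k _ ⟨h1, h2⟩; simp [h1, h2]
      · simp
      · simp
    refine ⟨fun k => ?_, fun k h1 h2 => ?_⟩
    · rw [hb]; split_ifs <;> simp [hα, hβ]
    · rw [hb]; simp [h1, h2]
  · rintro ⟨hz, h⟩
    refine ⟨bary ha i z, bary ha j z, hz i, hz j, ?_⟩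
    rw [← sum_bary ha z, Finset.sum_eq_add i j hij]
    · rintro k _ ⟨h1, h2⟩; simp [h k h1 h2]
    · simp
    · simp

theorem bary_eq_zero_of_mem_hypSegment {k : Fin 3} {x y z : ℍ} (hx : bary ha k x = 0)
    (hy : bary ha k y = 0) (hz : z ∈ hypSegment x y) : bary ha k z = 0 := by
  obtain ⟨α, β, -, -, h⟩ := mem_hypSegment_iff.1 hz
  rw [bary] at *
  rw [h]; simp [hx, hy]

theorem eq_vertex_of_bary {j : Fin 3} {z : ℍ} (hz : z ∈ closedTri ha)
    (h : ∀ k, k ≠ j → bary ha k z = 0) : z = a j := by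
  have h1 := sum_bary ha z
  rw [Finset.sum_eq_single j (fun k _ hk => by rw [h k hk, zero_smul]) (by simp)] at h1
  have h2 := mink_hyp_self z
  rw [← h1] at h2
  simp [mink_hyp_self] at h2
  have h3 : bary ha j z = 1 := by
    have := hz j
    nlinarith
  rw [h3, one_smul] at h1
  exact (hyp_injective h1).symm

include ha in
theorem vertex_injective : Function.Injective a := fun _ _ h =>
  ha.injective (congrArg hyp h)

/-- The radius at the `i`-th vertex of the three mutually tangent circles centred at the vertices
of the triangle `a`. -/
noncomputable def triRadius (a : Fin 3 → ℍ) (i : Fin 3) : ℝ :=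
  (dist (a i) (a (i + 1)) + dist (a i) (a (i + 2)) - dist (a (i + 1)) (a (i + 2))) / 2

theorem triRadius_add (a : Fin 3 → ℍ) {i j : Fin 3} (hij : i ≠ j) :
    triRadius a i + triRadius a j = dist (a i) (a j) := by
  have h1 : (1 : Fin 3) + 1 = 2 := rfl
  have h2 : (1 : Fin 3) + 2 = 0 := rfl
  have h3 : (2 : Fin 3) + 1 = 0 := rfl
  have h4 : (2 : Fin 3) + 2 = 1 := rfl
  have := dist_comm (a 0) (a 1)
  have := dist_comm (a 0) (a 2)
  have := dist_comm (a 1) (a 2)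
  fin_cases i <;> fin_cases j <;> simp_all [triRadius] <;> linarith

include ha in
theorem triRadius_pos (i : Fin 3) : 0 < triRadius a i := by
  have hne : ∀ i : Fin 3, i ≠ i + 1 ∧ i ≠ i + 2 ∧ i + 1 ≠ i + 2 := by decide
  obtain ⟨h1, h2, h3⟩ := hne i
  have hlt : dist (a (i + 1)) (a (i + 2)) < dist (a (i + 1)) (a i) + dist (a i) (a (i + 2)) := by
    refine lt_of_le_of_ne (dist_triangle _ _ _) fun h => ?_
    have hmem : a i ∈ hypSegment (a (i + 1)) (a (i + 2)) := h.symm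
    have := ((mem_hypSegment_vertices_iff ha h3).1 hmem).2 i h1 h2
    rw [bary_vertex] at this
    simp at this
  rw [triRadius, dist_comm (a i) (a (i + 1))]
  linarith

/-- The disc of radius `triRadius a i` about the `i`-th vertex does not reach the opposite side. -/
theorem bary_pos_of_dist_le {i : Fin 3} {z : ℍ} (hz : z ∈ closedTri ha)
    (hd : dist (a i) z ≤ triRadius a i) : 0 < bary ha i z := by
  refine lt_of_le_of_ne (hz i) fun h0 => ?_
  have hne : ∀ i : Fin 3, i ≠ i + 1 ∧ i ≠ i + 2 ∧ i + 1 ≠ i + 2 ∧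
      ∀ k, k ≠ i + 1 → k ≠ i + 2 → k = i := by decide
  obtain ⟨h1, h2, h3, hall⟩ := hne i
  have hseg : z ∈ hypSegment (a (i + 1)) (a (i + 2)) :=
    (mem_hypSegment_vertices_iff ha h3).2 ⟨hz, fun k k1 k2 => by rw [hall k k1 k2, ← h0]⟩
  have key : ∀ j, j ≠ i → dist (a j) z ≤ triRadius a j → False := by
    intro j hj hjd
    have hsum := triRadius_add a hj.symm
    have htri := dist_triangle (a i) z (a j)
    rw [dist_comm z (a j)] at htri
    have hmem : z ∈ hypSegment (a i) (a j) := by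
      change dist (a i) z + dist z (a j) = dist (a i) (a j)
      rw [dist_comm z (a j)]
      linarith
    have hzj : z = a j := by
      apply eq_vertex_of_bary ha hz
      intro k hk
      by_cases hki : k = i
      · rw [hki, ← h0]
      · exact ((mem_hypSegment_vertices_iff ha hj.symm).1 hmem).2 k hki hk
    rw [hzj] at hd
    linarith [triRadius_pos ha j]
  have hs : dist (a (i + 1)) z + dist z (a (i + 2)) = dist (a (i + 1)) (a (i + 2)) := hseg
  rw [← triRadius_add a h3] at hs
  by_cases hc : dist (a (i + 1)) z ≤ triRadius a (i + 1)
  · exact key _ h1.symm hc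
  · exact key _ h2.symm (by rw [dist_comm]; linarith)

/-- The homeomorphism of the standard simplex onto the closed triangle. -/
noncomputable def simplexMap (a : Fin 3 → ℍ) (t : stdSimplex ℝ (Fin 3)) : ℍ := baryPoint a t

theorem exists_bary_simplexMap (t : stdSimplex ℝ (Fin 3)) :
    ∃ l : ℝ, 0 < l ∧ ∀ i, bary ha i (simplexMap a t) = l * t i := by
  apply exists_bary_baryPoint ha t.2.1
  by_contra hn
  push Not at hn
  have := stdSimplex.sum_eq_one t
  have h0 : ∀ i, t i = 0 := fun i => le_antisymm (hn i) (t.2.1 i)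
  simp [h0] at this

theorem continuous_simplexMap (a : Fin 3 → ℍ) : Continuous (simplexMap a) := by
  apply (continuousOn_baryPoint a).comp_continuous continuous_subtype_val
  intro t
  refine ⟨t.2.1, ?_⟩
  by_contra hn
  push Not at hn
  have := stdSimplex.sum_eq_one t
  have h0 : ∀ i, t i = 0 := fun i => le_antisymm (hn i) (t.2.1 i)
  simp [h0] at this

include ha in
theorem simplexMap_injective : Function.Injective (simplexMap a) := by
  intro s t h
  obtain ⟨l, hl, hs⟩ := exists_bary_simplexMap ha s
  obtain ⟨m, hm, ht⟩ := exists_bary_simplexMap ha t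
  have h1 : ∀ i, l * s i = m * t i := fun i => by rw [← hs, ← ht, h]
  have hlm : l = m := by
    have e1 := stdSimplex.sum_eq_one s
    have e2 := stdSimplex.sum_eq_one t
    calc l = l * ∑ i, s i := by rw [e1, mul_one]
      _ = ∑ i, l * s i := Finset.mul_sum _ _ _
      _ = ∑ i, m * t i := by simp only [h1]
      _ = m * ∑ i, t i := (Finset.mul_sum _ _ _).symm
      _ = m := by rw [e2, mul_one]
  ext i
  have := h1 i
  rw [hlm] at this
  exact mul_left_cancel₀ hm.ne' this

theorem exists_simplexMap_eq {z : ℍ} (hz : z ∈ closedTri ha) : ∃ t, simplexMap a t = z := by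
  set σ := ∑ i, bary ha i z with hσ
  have hpos : 0 < σ := by
    refine lt_of_le_of_ne (Finset.sum_nonneg fun i _ => hz i) fun h => ?_
    have h0 : ∀ i, bary ha i z = 0 := fun i =>
      (Finset.sum_eq_zero_iff_of_nonneg fun i _ => hz i).1 h.symm i (Finset.mem_univ _)
    have := sum_bary ha z
    simp only [h0, zero_smul, Finset.sum_const_zero] at this
    have h1 := hyp_zero_pos z
    rw [← this] at h1
    simp at h1
  refine ⟨⟨fun i => bary ha i z / σ, fun i => div_nonneg (hz i) hpos.le, ?_⟩, ?_⟩
  · rw [← Finset.sum_div, ← hσ, div_self hpos.ne']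
  · apply unhyp_eq (inv_pos.2 hpos)
    rw [← sum_bary ha z, Finset.smul_sum]
    refine Finset.sum_congr rfl fun i _ => ?_
    change (bary ha i z / σ) • _ = _
    rw [smul_smul, div_eq_inv_mul]

theorem simplexMap_mem_closedTri (t : stdSimplex ℝ (Fin 3)) : simplexMap a t ∈ closedTri ha := by
  obtain ⟨l, hl, h⟩ := exists_bary_simplexMap ha t
  intro i
  rw [h]
  exact mul_nonneg hl.le (t.2.1 i)

theorem isCompact_closedTri : IsCompact (closedTri ha) := by
  have : closedTri ha = Set.range (simplexMap a) := by
    ext z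
    constructor
    · intro hz; exact exists_simplexMap_eq ha hz
    · rintro ⟨t, rfl⟩; exact simplexMap_mem_closedTri ha t
  rw [this]
  exact isCompact_range (continuous_simplexMap a)

theorem simplexMap_image_interior :
    simplexMap a '' {t | ∀ i, 0 < t i} = openTri ha := by
  ext z
  constructor
  · rintro ⟨t, ht, rfl⟩ i
    obtain ⟨l, hl, h⟩ := exists_bary_simplexMap ha t
    rw [h]; exact mul_pos hl (ht i)
  · intro hz
    obtain ⟨t, rfl⟩ := exists_simplexMap_eq ha (openTri_subset_closedTri ha hz)
    obtain ⟨l, hl, h⟩ := exists_bary_simplexMap ha t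
    refine ⟨t, fun i => ?_, rfl⟩
    have := hz i
    rw [h] at this
    exact pos_of_mul_pos_right this hl.le

include ha in
theorem simplexMap_image_side {i j k : Fin 3} (hij : i ≠ j) (hki : k ≠ i) (hkj : k ≠ j) :
    simplexMap a '' {t | t k = 0} = hypSegment (a i) (a j) := by
  ext z
  rw [mem_hypSegment_vertices_iff ha hij]
  constructor
  · rintro ⟨t, ht, rfl⟩
    refine ⟨simplexMap_mem_closedTri ha t, fun k' h1 h2 => ?_⟩
    obtain rfl : k' = k := by omega
    obtain ⟨l, hl, h⟩ := exists_bary_simplexMap ha t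
    have ht' : t k' = 0 := ht
    rw [h, ht', mul_zero]
  · rintro ⟨hz, h0⟩
    obtain ⟨t, rfl⟩ := exists_simplexMap_eq ha hz
    obtain ⟨l, hl, h⟩ := exists_bary_simplexMap ha t
    refine ⟨t, ?_, rfl⟩
    have := h0 k hki hkj
    rw [h] at this
    exact (mul_eq_zero.1 this).resolve_left hl.ne'

include ha in
theorem simplexMap_vertex {t : stdSimplex ℝ (Fin 3)} {i : Fin 3} (ht : t i = 1) :
    simplexMap a t = a i := by
  obtain ⟨l, hl, h⟩ := exists_bary_simplexMap ha t
  apply eq_vertex_of_bary ha (simplexMap_mem_closedTri ha t)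
  intro k hk
  have hsum := stdSimplex.sum_eq_one t
  have hle : t i + t k ≤ 1 := by
    rw [← hsum, ← Finset.sum_pair hk.symm]
    exact Finset.sum_le_sum_of_subset_of_nonneg (Finset.subset_univ _) fun j _ _ => t.2.1 j
  have : t k = 0 := le_antisymm (by linarith) (t.2.1 k)
  rw [h, this, mul_zero]

end Triangle

/-! ### Nondegeneracy and the region of a hyperbolic triangle -/

theorem cayley_self (z : ℍ) : cayley z z = 0 := by simp [cayley]

theorem cayley_denom_ne_zero (z w : ℍ) : (w : ℂ) - (starRingEnd ℂ) (z : ℂ) ≠ 0 := by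
  intro h
  have := congrArg Complex.im h
  simp at this
  linarith [z.im_pos, w.im_pos]

/-- The linear functional `v ↦ v 2 - 2 * z * v 1 + z ^ 2 * v 0`, which kills `hyp z`, takes `hyp w`
to a positive multiple of the Cayley coordinate of `w` centred at `z`. Thus linear relations in the
hyperboloid model become linear relations between Cayley coordinates. -/
theorem exists_cayley_eq (z w : ℍ) : ∃ k : ℝ, 0 < k ∧
    ((hyp w 2 : ℂ) - 2 * z * hyp w 1 + (z : ℂ) ^ 2 * hyp w 0) = k * cayley z w := by
  have hne := cayley_denom_ne_zero z w
  refine ⟨Complex.normSq ((w : ℂ) - (starRingEnd ℂ) (z : ℂ)) / w.im,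
    div_pos (Complex.normSq_pos.2 hne) w.im_pos, ?_⟩
  have hw : (w.im : ℂ) ≠ 0 := by exact_mod_cast w.im_ne_zero
  rw [cayley]
  push_cast
  rw [Complex.normSq_eq_conj_mul_self]
  simp only [hyp_zero, hyp_one, hyp_two, map_sub, Complex.conj_conj]
  field_simp
  push_cast
  have e1 : (w : ℂ) = w.re + w.im * Complex.I := (UpperHalfPlane.re_add_im w).symm
  have e2 : (starRingEnd ℂ) (w : ℂ) = w.re - w.im * Complex.I := by
    rw [e1]; simp [Complex.ext_iff]
  rw [e2, e1]
  simp
  field_simp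
  ring_nf
  rw [Complex.I_sq]
  ring

theorem cayley_injective (z : ℍ) : Function.Injective (cayley z) := by
  intro w w' h
  have h1 := cayley_denom_ne_zero z w
  have h2 := cayley_denom_ne_zero z w'
  rw [cayley, cayley, div_eq_div_iff h1 h2] at h
  have h3 : ((w : ℂ) - w') * (z - (starRingEnd ℂ) (z : ℂ)) = 0 := by linear_combination h
  rcases mul_eq_zero.1 h3 with h4 | h4
  · exact UpperHalfPlane.coe_injective (sub_eq_zero.1 h4)
  · exact absurd h4 (cayley_denom_ne_zero z z)

theorem cayley_eq_zero_iff {z w : ℍ} : cayley z w = 0 ↔ w = z := by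
  rw [← cayley_self z, (cayley_injective z).eq_iff]

namespace HypTriangle

variable {p q r : ℕ} (T : HypTriangle p q r)

/-- The vertices of the triangle. -/
def pt : Fin 3 → ℍ := ![T.A, T.B, T.C]

/-- The angle `π / p` is neither `0` nor `π`, so the vertices do not lie on a geodesic. -/
theorem linearIndependent_pt (hp : 2 ≤ p) : LinearIndependent ℝ fun i => hyp (T.pt i) := by
  rw [Fintype.linearIndependent_iff]
  intro c hc
  simp only [Fin.sum_univ_three] at hc
  obtain ⟨k0, hk0, e0⟩ := exists_cayley_eq T.A T.A
  obtain ⟨k1, hk1, e1⟩ := exists_cayley_eq T.A T.B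
  obtain ⟨k2, hk2, e2⟩ := exists_cayley_eq T.A T.C
  have hB : cayley T.A T.B ≠ 0 := fun h => T.ne_AB (cayley_eq_zero_iff.1 h).symm
  have hC : cayley T.A T.C ≠ 0 := fun h => T.ne_CA (cayley_eq_zero_iff.1 h)
  have hang : InnerProductGeometry.angle (cayley T.A T.B) (cayley T.A T.C) = Real.pi / p :=
    T.angle_A
  have hp0 : (0 : ℝ) < p := by positivity
  have hpos : 0 < Real.pi / p := div_pos Real.pi_pos hp0
  have hlt : Real.pi / p < Real.pi := by
    apply div_lt_self Real.pi_pos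
    exact_mod_cast (by omega : 1 < p)
  have hpar : ∀ s : ℝ, cayley T.A T.C ≠ (s : ℂ) * cayley T.A T.B := by
    intro s h
    rcases lt_trichotomy s 0 with hs | rfl | hs
    · have : InnerProductGeometry.angle (cayley T.A T.B) (cayley T.A T.C) = Real.pi :=
        InnerProductGeometry.angle_eq_pi_iff.2 ⟨hB, s, hs, by rw [h, Complex.real_smul]⟩
      linarith
    · exact hC (by rw [h]; simp)
    · have : InnerProductGeometry.angle (cayley T.A T.B) (cayley T.A T.C) = 0 :=
        InnerProductGeometry.angle_eq_zero_iff.2 ⟨hB, s, hs, by rw [h, Complex.real_smul]⟩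
      linarith
  have f0 := congrArg (fun x : ℝ => (x : ℂ)) (congrFun hc 0)
  have f1 := congrArg (fun x : ℝ => (x : ℂ)) (congrFun hc 1)
  have f2 := congrArg (fun x : ℝ => (x : ℂ)) (congrFun hc 2)
  simp only [pt, Matrix.cons_val_zero, Matrix.cons_val_one, Matrix.cons_val_two, Matrix.head_cons,
    Matrix.tail_cons, Pi.add_apply, Pi.smul_apply, smul_eq_mul, Pi.zero_apply,
    Complex.ofReal_add, Complex.ofReal_mul, Complex.ofReal_zero] at f0 f1 f2
  rw [cayley_self, mul_zero] at e0
  have hrel : (c 1 * k1 : ℂ) * cayley T.A T.B + (c 2 * k2 : ℂ) * cayley T.A T.C = 0 := by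
    linear_combination f2 - 2 * T.A * f1 + (T.A : ℂ) ^ 2 * f0 - c 0 * e0 - c 1 * e1 - c 2 * e2
  have h2 : c 2 = 0 := by
    by_contra h2
    have h2' : ((c 2 : ℝ) : ℂ) ≠ 0 := by exact_mod_cast h2
    have hk2' : ((k2 : ℝ) : ℂ) ≠ 0 := by exact_mod_cast hk2.ne'
    apply hpar (-(c 1 * k1) / (c 2 * k2))
    push_cast
    field_simp
    linear_combination hrel
  have h1 : c 1 = 0 := by
    rw [h2] at hrel
    simp [hB, hk1.ne'] at hrel
    exact hrel
  have h0 : c 0 = 0 := by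
    have := congrFun hc 0
    rw [h1, h2] at this
    simp only [zero_smul, add_zero, Pi.smul_apply, smul_eq_mul, Pi.zero_apply] at this
    exact (mul_eq_zero.1 this).resolve_right (hyp_zero_pos _).ne'
  intro i; fin_cases i
  exacts [h0, h1, h2]

variable (hT : LinearIndependent ℝ fun i => hyp (T.pt i))

/-- The union of the segments from `A` to the side `BC` is the triangle in barycentric
coordinates. -/
theorem region_eq : T.region = closedTri hT := by
  ext w
  constructor
  · rintro ⟨v, hv, hw⟩
    obtain ⟨α, β, hα, hβ, h1⟩ := mem_hypSegment_iff.1 hv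
    obtain ⟨α', β', hα', hβ', h2⟩ := mem_hypSegment_iff.1 hw
    have hb : ∀ i, bary hT i w = ![α', β' * α, β' * β] i := by
      apply bary_eq hT
      rw [h2, h1, Fin.sum_univ_three]
      simp [pt, smul_smul, add_assoc]
    intro i
    rw [hb]
    fin_cases i
    exacts [hα', mul_nonneg hβ' hα, mul_nonneg hβ' hβ]
  · intro hw
    have hsum := sum_bary hT w
    rw [Fin.sum_univ_three] at hsum
    by_cases h : bary hT 1 w = 0 ∧ bary hT 2 w = 0
    · have : w = T.pt 0 := by
        apply eq_vertex_of_bary hT hw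
        intro k hk
        fin_cases k
        · exact absurd rfl hk
        · exact h.1
        · exact h.2
      rw [this]
      exact T.A_mem
    · let c : Fin 3 → ℝ := ![0, bary hT 1 w, bary hT 2 w]
      have hc : ∀ i, 0 ≤ c i := by
        intro i; fin_cases i
        exacts [le_rfl, hw 1, hw 2]
      have hc' : ∃ i, 0 < c i := by
        by_contra hn
        push Not at hn
        exact h ⟨le_antisymm (hn 1) (hw 1), le_antisymm (hn 2) (hw 2)⟩
      obtain ⟨l, hl, hb⟩ := exists_bary_baryPoint hT hc hc'
      have hv := sum_bary hT (baryPoint T.pt c)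
      simp only [hb, Fin.sum_univ_three] at hv
      refine ⟨baryPoint T.pt c, mem_hypSegment_iff.2 ⟨l * c 1, l * c 2, mul_nonneg hl.le (hc 1),
        mul_nonneg hl.le (hc 2), ?_⟩, mem_hypSegment_iff.2 ⟨bary hT 0 w, l⁻¹, hw 0,
        inv_nonneg.2 hl.le, ?_⟩⟩
      · rw [← hv]
        simp [c, pt]
      · rw [← hv, ← hsum]
        simp only [c, pt, smul_add, smul_smul]
        simp [hl.ne', add_assoc]

theorem mem_boundary_iff (x : T.region) : x ∈ T.boundary ↔ ∃ k, bary hT k x = 0 := by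
  have hx : (x : ℍ) ∈ closedTri hT := by rw [← T.region_eq hT]; exact x.2
  have h01 := mem_hypSegment_vertices_iff hT (i := 0) (j := 1) (z := x) (by decide)
  have h12 := mem_hypSegment_vertices_iff hT (i := 1) (j := 2) (z := x) (by decide)
  have h20 := mem_hypSegment_vertices_iff hT (i := 2) (j := 0) (z := x) (by decide)
  have hd : x ∈ T.boundary ↔ ((x : ℍ) ∈ hypSegment (T.pt 0) (T.pt 1) ∨
      (x : ℍ) ∈ hypSegment (T.pt 1) (T.pt 2)) ∨ (x : ℍ) ∈ hypSegment (T.pt 2) (T.pt 0) := Iff.rfl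
  rw [hd, h01, h12, h20]
  simp only [hx, true_and]
  constructor
  · rintro ((h | h) | h)
    · exact ⟨2, h 2 (by decide) (by decide)⟩
    · exact ⟨0, h 0 (by decide) (by decide)⟩
    · exact ⟨1, h 1 (by decide) (by decide)⟩
  · rintro ⟨k, hk⟩
    have hall : ∀ i j k k' : Fin 3, i ≠ j → k ≠ i → k ≠ j → k' ≠ i → k' ≠ j → k' = k := by decide
    fin_cases k
    · exact .inl (.inr fun k' h1 h2 => by
        rw [hall 1 2 0 k' (by decide) (by decide) (by decide) h1 h2]; exact hk)
    · exact .inr fun k' h1 h2 => by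
        rw [hall 2 0 1 k' (by decide) (by decide) (by decide) h1 h2]; exact hk
    · exact .inl (.inl fun k' h1 h2 => by
        rw [hall 0 1 2 k' (by decide) (by decide) (by decide) h1 h2]; exact hk)

end HypTriangle

/-! ### The two sheets of the turnover -/

namespace HypTriangle

variable {p q r : ℕ} (T : HypTriangle p q r)

open Classical in
/-- The two copies of the triangle in the turnover, as maps defined on all of `ℍ`; the value outside
the triangle is immaterial. -/
noncomputable def sheet (b : Bool) (z : ℍ) : T.Turnover :=
  if h : z ∈ T.region then (if b then T.front ⟨z, h⟩ else T.back ⟨z, h⟩)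
  else T.front ⟨T.A, T.A_mem⟩

theorem front_eq_sheet (x : T.region) : T.front x = T.sheet true x := by
  simp [sheet, x.2]

theorem back_eq_sheet (x : T.region) : T.back x = T.sheet false x := by
  simp [sheet, x.2]

theorem front_isometry : Isometry T.front := Metric.toGlueL_isometry _ _

theorem back_isometry : Isometry T.back := Metric.toGlueR_isometry _ _

theorem front_eq_back {x : T.region} (hx : x ∈ T.boundary) : T.front x = T.back x :=
  congrFun (Metric.toGlue_commute (isometry_subtype_coe : Isometry ((↑) : T.boundary → T.region))
    (isometry_subtype_coe : Isometry ((↑) : T.boundary → T.region))) ⟨x, hx⟩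

theorem dist_front_back (x y : T.region) :
    dist (T.front x) (T.back y) = ⨅ k : T.boundary, dist x k + dist y k :=
  add_zero (⨅ k : T.boundary, dist x (k : T.region) + dist y (k : T.region))

theorem exists_front_or_back (y : T.Turnover) : (∃ x, T.front x = y) ∨ ∃ x, T.back x = y := by
  induction y using Quotient.inductionOn with
  | h s =>
    rcases s with x | x
    · exact .inl ⟨x, rfl⟩
    · exact .inr ⟨x, rfl⟩

variable (hT : LinearIndependent ℝ fun i => hyp (T.pt i))

theorem eq_of_front_eq_back {x y : T.region} (h : T.front x = T.back y) :
    x = y ∧ ∃ k, bary hT k x = 0 := by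
  have h0 : ⨅ k : T.boundary, dist x (k : T.region) + dist y (k : T.region) = 0 := by
    rw [← dist_front_back, h, dist_self]
  have hex : ∀ ε > 0, ∃ k : T.boundary, dist x (k : T.region) + dist y (k : T.region) < ε := by
    intro ε hε
    apply exists_lt_of_ciInf_lt
    rw [h0]; exact hε
  have hxy : x = y := by
    rw [← dist_le_zero]
    apply le_of_forall_pos_le_add
    intro ε hε
    obtain ⟨k, hk⟩ := hex ε hε
    linarith [dist_triangle_right x y (k : T.region)]
  refine ⟨hxy, ?_⟩
  have hclosed : IsClosed {z : T.region | ∃ k, bary hT k z = 0} := by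
    have : {z : T.region | ∃ k, bary hT k z = 0} = ⋃ k, {z : T.region | bary hT k z = 0} := by
      ext; simp
    rw [this]
    exact isClosed_iUnion_of_finite fun k =>
      isClosed_eq ((continuous_bary hT k).comp continuous_subtype_val) continuous_const
  have : x ∈ closure {z : T.region | ∃ k, bary hT k z = 0} := by
    rw [Metric.mem_closure_iff]
    intro ε hε
    obtain ⟨k, hk⟩ := hex ε hε
    exact ⟨k, (T.mem_boundary_iff hT k).1 k.2, by
      linarith [dist_nonneg (x := y) (y := (k : T.region))]⟩
  rw [hclosed.closure_eq] at this
  exact this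

theorem sheet_eq_front {z : ℍ} (h : z ∈ T.region) : T.sheet true z = T.front ⟨z, h⟩ :=
  (T.front_eq_sheet ⟨z, h⟩).symm

theorem sheet_eq_back {z : ℍ} (h : z ∈ T.region) : T.sheet false z = T.back ⟨z, h⟩ :=
  (T.back_eq_sheet ⟨z, h⟩).symm

theorem dist_sheet (b : Bool) {x y : ℍ} (hx : x ∈ closedTri hT) (hy : y ∈ closedTri hT) :
    dist (T.sheet b x) (T.sheet b y) = dist x y := by
  rw [← T.region_eq hT] at hx hy
  cases b
  · rw [T.sheet_eq_back hx, T.sheet_eq_back hy, T.back_isometry.dist_eq]; rfl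
  · rw [T.sheet_eq_front hx, T.sheet_eq_front hy, T.front_isometry.dist_eq]; rfl

theorem sheet_eq_sheet (b b' : Bool) {x : ℍ} (hx : x ∈ closedTri hT) {k : Fin 3}
    (hk : bary hT k x = 0) : T.sheet b x = T.sheet b' x := by
  rw [← T.region_eq hT] at hx
  have := T.front_eq_back ((T.mem_boundary_iff hT ⟨x, hx⟩).2 ⟨k, hk⟩)
  cases b <;> cases b' <;> simp only [T.sheet_eq_front hx, T.sheet_eq_back hx, this]

theorem exists_sheet_eq (y : T.Turnover) : ∃ b, ∃ x ∈ closedTri hT, T.sheet b x = y := by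
  rw [← T.region_eq hT]
  rcases T.exists_front_or_back y with ⟨x, rfl⟩ | ⟨x, rfl⟩
  · exact ⟨true, x, x.2, (T.front_eq_sheet x).symm⟩
  · exact ⟨false, x, x.2, (T.back_eq_sheet x).symm⟩

theorem eq_of_sheet_eq {b b' : Bool} {x y : ℍ} (hx : x ∈ closedTri hT) (hy : y ∈ closedTri hT)
    (h : T.sheet b x = T.sheet b' y) : x = y ∧ (b = b' ∨ ∃ k, bary hT k x = 0) := by
  by_cases hb : b = b'
  · subst hb
    refine ⟨?_, .inl rfl⟩
    rw [← dist_eq_zero, ← T.dist_sheet hT b hx hy, h, dist_self]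
  · have hx' := hx
    have hy' := hy
    rw [← T.region_eq hT] at hx' hy'
    cases b <;> cases b' <;> simp only [T.sheet_eq_front hx', T.sheet_eq_back hx',
      T.sheet_eq_front hy', T.sheet_eq_back hy'] at h
    · exact absurd rfl hb
    · obtain ⟨h1, h2⟩ := T.eq_of_front_eq_back hT h.symm
      have h1 : y = x := congrArg Subtype.val h1
      subst h1
      exact ⟨rfl, .inr h2⟩
    · obtain ⟨h1, h2⟩ := T.eq_of_front_eq_back hT h
      have h1 : x = y := congrArg Subtype.val h1
      exact ⟨h1, .inr h2⟩
    · exact absurd rfl hb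

/-- The open sheet is the complement of the other, compact, sheet. -/
theorem isOpen_sheet_image (b : Bool) : IsOpen (T.sheet b '' openTri hT) := by
  have hcompl : T.sheet b '' openTri hT = (T.sheet (!b) '' closedTri hT)ᶜ := by
    ext y
    constructor
    · rintro ⟨x, hx, rfl⟩ ⟨x', hx', h⟩
      obtain ⟨rfl, h2 | ⟨k, hk⟩⟩ :=
        T.eq_of_sheet_eq hT hx' (openTri_subset_closedTri hT hx) h
      · simp at h2
      · exact (hx k).ne' hk
    · intro hy
      obtain ⟨b', x, hx, rfl⟩ := T.exists_sheet_eq hT y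
      have hpos : ∀ k, bary hT k x ≠ 0 := fun k hk =>
        hy ⟨x, hx, T.sheet_eq_sheet hT _ _ hx hk⟩
      have hb : b' = b := by
        by_contra hb
        apply hy
        refine ⟨x, hx, ?_⟩
        rw [(by cases b <;> cases b' <;> simp_all : b' = !b)]
      subst hb
      exact ⟨x, fun k => lt_of_le_of_ne (hx k) (hpos k).symm, rfl⟩
  rw [hcompl, isOpen_compl_iff]
  apply IsCompact.isClosed
  apply (isCompact_closedTri hT).image_of_continuousOn
  have : LipschitzOnWith 1 (T.sheet (!b)) (closedTri hT) :=
    LipschitzOnWith.of_dist_le_mul fun x hx y hy => by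
      rw [T.dist_sheet hT _ hx hy]; simp
  exact this.continuousOn

/-- The cone points of the turnover. -/
noncomputable def conePt (i : Fin 3) : T.Turnover := T.sheet true (T.pt i)

include hT in
theorem sheet_pt (b : Bool) (i : Fin 3) : T.sheet b (T.pt i) = T.conePt i := by
  have hne : i + 1 ≠ i := by revert i; decide
  apply T.sheet_eq_sheet hT b true (vertex_mem_closedTri hT i) (k := i + 1)
  rw [bary_vertex]; simp

theorem coneOrder_ne_zero (hp : 2 ≤ p) (hq : 2 ≤ q) (hr : 2 ≤ r) (y : T.Turnover) :
    T.coneOrder y ≠ 0 := by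
  rw [coneOrder]
  split_ifs <;> omega

theorem coneOrder_eq_one {y : T.Turnover} (h : ∀ i, y ≠ T.conePt i) : T.coneOrder y = 1 := by
  have h0 : y ≠ T.sheet true T.A := h 0
  have h1 : y ≠ T.sheet true T.B := h 1
  have h2 : y ≠ T.sheet true T.C := h 2
  rw [coneOrder, T.front_eq_sheet, T.front_eq_sheet, T.front_eq_sheet]
  rw [if_neg h0, if_neg h1, if_neg h2]

theorem sheet_ne_conePt {b : Bool} {x : ℍ} (hx : x ∈ closedTri hT) {i : Fin 3} (h : x ≠ T.pt i) :
    T.sheet b x ≠ T.conePt i := fun h' =>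
  h (T.eq_of_sheet_eq hT hx (vertex_mem_closedTri hT i) h').1

theorem sheet_ne_conePt_of_mem_openTri {b : Bool} {x : ℍ} (hx : x ∈ openTri hT) (i : Fin 3) :
    T.sheet b x ≠ T.conePt i := by
  apply T.sheet_ne_conePt hT (openTri_subset_closedTri hT hx)
  rintro rfl
  have hne : ∀ i : Fin 3, i + 1 ≠ i := by decide
  have := hx (i + 1)
  rw [bary_vertex, if_neg (hne i)] at this
  exact lt_irrefl _ this

theorem dist_conePt_sheet (i : Fin 3) {b : Bool} {x : ℍ} (hx : x ∈ closedTri hT) :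
    dist (T.conePt i) (T.sheet b x) = dist (T.pt i) x := by
  rw [← T.sheet_pt hT b, T.dist_sheet hT b (vertex_mem_closedTri hT i) hx]

end HypTriangle

/-! ### Branched coverings of the turnover by the hyperbolic plane -/

variable {p q r : ℕ} {T : HypTriangle p q r}

/-- `F : ℍ → S(p,q,r)` is a branched covering: the local condition of `IsBranchedCover`, on the
universal cover. -/
def IsBranchedDevelopment (F : ℍ → T.Turnover) : Prop :=
  ∀ z : ℍ, ∃ ε > 0, F '' Metric.ball z ε = Metric.ball (F z) ε ∧
    ∀ a ∈ Metric.ball z ε, ∀ b ∈ Metric.ball z ε,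
      IsLeast {d : ℝ | ∃ b' : ℍ, cayley z b' ^ T.coneOrder (F z) =
          cayley z b ^ T.coneOrder (F z) ∧ d = dist a b'} (dist (F a) (F b))

/-- The isometry `g` of `ℍ` moves one copy of the triangle to a lift of the sheet `b`. -/
def IsLift (F : ℍ → T.Turnover) (hT : LinearIndependent ℝ fun i => hyp (T.pt i)) (b : Bool)
    (g : ℍ ≃ᵢ ℍ) : Prop :=
  ∀ x ∈ closedTri hT, F (g x) = T.sheet b x

/-- A point `c'` whose distances to the `g`-images of three points in general position are those of
`c` to the points themselves is the `g`-image of `c`. -/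
theorem eq_of_dist_eq_image {a : Fin 3 → ℍ}
    (ha : LinearIndependent ℝ fun i => hyp (a i)) (g : ℍ ≃ᵢ ℍ) {c c' : ℍ}
    (h : ∀ i, dist c' (g (a i)) = dist c (a i)) : c' = g c := by
  obtain ⟨d, rfl⟩ := g.surjective c'
  congr 1
  apply eq_of_dist_eq ha
  intro i
  rw [← h i, g.isometry.dist_eq]

namespace IsBranchedDevelopment

variable {F : ℍ → T.Turnover} (hF : IsBranchedDevelopment F)

include hF

theorem exists_local_lipschitz (z : ℍ) :
    ∃ ε > 0, ∀ a ∈ Metric.ball z ε, ∀ b ∈ Metric.ball z ε, dist (F a) (F b) ≤ dist a b := by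
  obtain ⟨ε, hε, -, h⟩ := hF z
  exact ⟨ε, hε, fun a ha b hb => (h a ha b hb).2 ⟨b, rfl, rfl⟩⟩

/-- Near every point `z`, cone points included, `F` preserves distances to `z`, since `z` is fixed by
the local rotations. -/
theorem exists_ball_dist_center (hn : ∀ y, T.coneOrder y ≠ 0) (z : ℍ) :
    ∃ ε > 0, F '' Metric.ball z ε = Metric.ball (F z) ε ∧
      ∀ a ∈ Metric.ball z ε, dist (F a) (F z) = dist a z := by
  obtain ⟨ε, hε, himg, h⟩ := hF z
  refine ⟨ε, hε, himg, fun a ha => ?_⟩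
  obtain ⟨b', hb', hd⟩ := (h a ha z (Metric.mem_ball_self hε)).1
  rw [cayley_self, zero_pow (hn _), pow_eq_zero_iff (hn _), cayley_eq_zero_iff] at hb'
  rw [hd, hb']

theorem exists_local_isometry {z : ℍ} (hz : ∀ i, F z ≠ T.conePt i) :
    ∃ ε > 0, F '' Metric.ball z ε = Metric.ball (F z) ε ∧
      ∀ a ∈ Metric.ball z ε, ∀ b ∈ Metric.ball z ε, dist (F a) (F b) = dist a b := by
  obtain ⟨ε, hε, himg, h⟩ := hF z
  refine ⟨ε, hε, himg, fun a ha b hb => ?_⟩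
  obtain ⟨b', hb', hd⟩ := (h a ha b hb).1
  rw [T.coneOrder_eq_one hz, pow_one, pow_one] at hb'
  rw [hd, cayley_injective z hb']

theorem continuous : Continuous F := by
  rw [continuous_iff_continuousAt]
  intro z
  obtain ⟨ε, hε, h⟩ := hF.exists_local_lipschitz z
  have : LipschitzOnWith 1 F (Metric.ball z ε) :=
    LipschitzOnWith.of_dist_le_mul fun a ha b hb => by simpa using h a ha b hb
  exact this.continuousOn.continuousAt (Metric.ball_mem_nhds z hε)

/-- A locally `1`-Lipschitz map on a geodesic space is `1`-Lipschitz. -/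
theorem dist_le (a b : ℍ) : dist (F a) (F b) ≤ dist a b := by
  rcases eq_or_ne a b with rfl | hab
  · simp
  obtain ⟨γ, hγ, h0, h1⟩ := exists_geodesic hab
  have hcont : Continuous fun t => F (γ t) := hF.continuous.comp hγ.continuous
  have key : Set.Icc (0 : ℝ) (dist a b) ⊆ {t | dist (F a) (F (γ t)) ≤ t} := by
    apply IsClosed.Icc_subset_of_forall_exists_gt
    · apply IsClosed.inter _ isClosed_Icc
      exact isClosed_le (continuous_const.dist hcont) continuous_id
    · simp [h0]
    · rintro t ⟨ht, ht0, ht1⟩ y hy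
      obtain ⟨ε, hε, h⟩ := hF.exists_local_lipschitz (γ t)
      have hy' : t < y := hy
      obtain ⟨s, hs1, hs2⟩ := exists_between (lt_min hy' (lt_add_of_pos_right t hε))
      have hs3 : s < y := hs2.trans_le (min_le_left _ _)
      have hs4 : s < t + ε := hs2.trans_le (min_le_right _ _)
      refine ⟨s, ?_, hs1, hs3.le⟩
      have hd : dist (γ t) (γ s) = s - t := by
        rw [hγ.dist_eq, Real.dist_eq, abs_sub_comm, abs_of_pos (by linarith)]
      have := h (γ t) (Metric.mem_ball_self hε) (γ s)
        (by rw [Metric.mem_ball, dist_comm, hd]; linarith)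
      have ht' : dist (F a) (F (γ t)) ≤ t := ht
      change dist (F a) (F (γ s)) ≤ s
      linarith [dist_triangle (F a) (F (γ t)) (F (γ s))]
  have := key ⟨dist_nonneg, le_rfl⟩
  rwa [Set.mem_ofPred_eq, h1] at this

variable (hT : LinearIndependent ℝ fun i => hyp (T.pt i))

/-- The values of `F` on the closed triangle are limits of those on the open triangle. -/
theorem isLift_of_openTri {b : Bool} {g : ℍ ≃ᵢ ℍ}
    (h : ∀ x ∈ openTri hT, F (g x) = T.sheet b x) : IsLift F hT b g := by
  intro x hx
  rw [← dist_le_zero]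
  apply le_of_forall_pos_le_add
  intro ε hε
  obtain ⟨y, hy, hxy⟩ := Metric.mem_closure_iff.1 (closedTri_subset_closure hT hx) (ε / 2)
    (by positivity)
  have h1 := hF.dist_le (g x) (g y)
  rw [g.isometry.dist_eq, h y hy] at h1
  have h2 := T.dist_sheet hT b (openTri_subset_closedTri hT hy) hx
  have := dist_triangle (F (g x)) (T.sheet b y) (T.sheet b x)
  rw [dist_comm] at h2
  rw [dist_comm (T.sheet b y), h2, dist_comm y x] at this
  linarith

/-- Analytic continuation: an isometry that agrees with a lift near one point is a lift. -/
theorem isLift_of_eventually {b : Bool} {g : ℍ ≃ᵢ ℍ} {x : ℍ} (hx : x ∈ openTri hT)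
    (h : ∀ᶠ y in nhds x, F (g y) = T.sheet b y) : IsLift F hT b g := by
  apply hF.isLift_of_openTri hT
  set u : Set ℍ := {y | ∀ᶠ z in nhds y, F (g z) = T.sheet b z} ∩ openTri hT with hu
  have huo : IsOpen u := isOpen_setOfPred_eventually_nhds.inter (isOpen_openTri hT)
  suffices hsub : openTri hT ⊆ u by
    intro y hy
    exact (hsub hy).1.self_of_nhds
  apply (isPreconnected_openTri hT).subset_of_closure_inter_subset huo ⟨x, hx, h, hx⟩
  rintro y ⟨hyu, hy⟩
  refine ⟨?_, hy⟩
  have hyF : F (g y) = T.sheet b y := by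
    rw [← dist_le_zero]
    apply le_of_forall_pos_le_add
    intro ε hε
    obtain ⟨z, hz, hyz⟩ := Metric.mem_closure_iff.1 hyu (ε / 2) (by positivity)
    have h1 := hF.dist_le (g y) (g z)
    rw [g.isometry.dist_eq, hz.1.self_of_nhds] at h1
    have h2 := T.dist_sheet hT b (openTri_subset_closedTri hT hy)
      (openTri_subset_closedTri hT hz.2)
    have := dist_triangle (F (g y)) (T.sheet b z) (T.sheet b y)
    rw [dist_comm (T.sheet b z), h2] at this
    linarith
  obtain ⟨ε, hε, himg, hiso⟩ := hF.exists_local_isometry (z := g y)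
    (by rw [hyF]; exact T.sheet_ne_conePt_of_mem_openTri hT hy)
  obtain ⟨δ, hδ, hball⟩ := Metric.isOpen_iff.1 (isOpen_openTri hT) y hy
  set ρ := min ε δ with hρ
  have hρ0 : 0 < ρ := lt_min hε hδ
  have hne : (u ∩ Metric.ball y ρ).Nonempty := by
    obtain ⟨z, hz, hyz⟩ := Metric.mem_closure_iff.1 hyu ρ hρ0
    exact ⟨z, hz, by rwa [Metric.mem_ball, dist_comm]⟩
  obtain ⟨a, haN, ha⟩ := exists_linearIndependent_hyp (huo.inter Metric.isOpen_ball) hne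
  filter_upwards [Metric.ball_mem_nhds y hρ0] with c hc
  have hcε : dist c y < ε := lt_of_lt_of_le hc (min_le_left _ _)
  have hcT : c ∈ closedTri hT := openTri_subset_closedTri hT
    (hball (lt_of_lt_of_le hc (min_le_right _ _) : dist c y < δ))
  have hmem : T.sheet b c ∈ Metric.ball (F (g y)) ε := by
    rw [Metric.mem_ball, hyF, T.dist_sheet hT b hcT (openTri_subset_closedTri hT hy)]
    exact hcε
  rw [← himg] at hmem
  obtain ⟨c', hc', hFc⟩ := hmem
  have : c' = g c := by
    apply eq_of_dist_eq_image ha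
    intro i
    have hai : dist (a i) y < ε := lt_of_lt_of_le (haN i).2 (min_le_left _ _)
    rw [← hiso c' hc' (g (a i)) (by rwa [Metric.mem_ball, g.isometry.dist_eq]), hFc,
      (haN i).1.1.self_of_nhds,
      T.dist_sheet hT b hcT (openTri_subset_closedTri hT (haN i).1.2)]
  rw [← this, hFc]

theorem exists_lift_of_mem_openTri {b : Bool} {x w : ℍ} (hx : x ∈ openTri hT)
    (hw : F w = T.sheet b x) : ∃ g, IsLift F hT b g ∧ g x = w := by
  obtain ⟨ε, hε, himg, hiso⟩ := hF.exists_local_isometry (z := w)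
    (by rw [hw]; exact T.sheet_ne_conePt_of_mem_openTri hT hx)
  obtain ⟨δ, hδ, hball⟩ := Metric.isOpen_iff.1 (isOpen_openTri hT) x hx
  set ρ := min ε δ with hρ
  have hρ0 : 0 < ρ := lt_min hε hδ
  have hT' : ∀ c ∈ Metric.ball x ρ, c ∈ closedTri hT := fun c hc =>
    openTri_subset_closedTri hT (hball (lt_of_lt_of_le hc (min_le_right _ _) : dist c x < δ))
  have hinv : ∀ c ∈ Metric.ball x ρ, ∃ c' ∈ Metric.ball w ε, F c' = T.sheet b c := by
    intro c hc
    have hmem : T.sheet b c ∈ Metric.ball (F w) ε := by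
      rw [Metric.mem_ball, hw, T.dist_sheet hT b (hT' c hc) (openTri_subset_closedTri hT hx)]
      exact lt_of_lt_of_le hc (min_le_left _ _)
    rwa [← himg] at hmem
  choose! k hk hFk using hinv
  have hkd : ∀ c ∈ Metric.ball x ρ, ∀ c' ∈ Metric.ball x ρ, dist (k c) (k c') = dist c c' := by
    intro c hc c' hc'
    rw [← hiso _ (hk c hc) _ (hk c' hc'), hFk c hc, hFk c' hc',
      T.dist_sheet hT b (hT' c hc) (hT' c' hc')]
  obtain ⟨a, haN, ha⟩ := exists_linearIndependent_hyp (N := Metric.ball x ρ) Metric.isOpen_ball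
    ⟨x, Metric.mem_ball_self hρ0⟩
  obtain ⟨g, hg⟩ := exists_isometryEquiv ha (w := fun i => k (a i))
    fun i j => (hkd _ (haN i) _ (haN j)).symm
  have hkg : ∀ c ∈ Metric.ball x ρ, k c = g c := fun c hc =>
    eq_of_dist_eq_image ha g fun i => by rw [hg, hkd _ hc _ (haN i)]
  have hxw : k x = w := by
    have hx0 : x ∈ Metric.ball x ρ := Metric.mem_ball_self hρ0
    rw [← dist_eq_zero, ← hiso _ (hk x hx0) w (Metric.mem_ball_self hε), hFk x hx0, hw, dist_self]
  refine ⟨g, ?_, by rw [← hkg x (Metric.mem_ball_self hρ0), hxw]⟩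
  apply hF.isLift_of_eventually hT hx
  filter_upwards [Metric.ball_mem_nhds x hρ0] with c hc
  rw [← hkg c hc, hFk c hc]

/-- Through every point over a point of a sheet there is a lift of that sheet. -/
theorem exists_lift (hn : ∀ y, T.coneOrder y ≠ 0) {b : Bool} {x w : ℍ} (hx : x ∈ closedTri hT)
    (hw : F w = T.sheet b x) : ∃ g, IsLift F hT b g ∧ g x = w := by
  obtain ⟨ε, hε, himg, hiso⟩ := hF.exists_ball_dist_center hn w
  obtain ⟨a, ha, hxa⟩ := Metric.mem_closure_iff.1 (closedTri_subset_closure hT hx) (ε / 2)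
    (by positivity)
  have hmem : T.sheet b a ∈ Metric.ball (F w) ε := by
    rw [Metric.mem_ball, hw, T.dist_sheet hT b (openTri_subset_closedTri hT ha) hx, dist_comm]
    linarith
  rw [← himg] at hmem
  obtain ⟨a', ha', hFa⟩ := hmem
  have hd : dist a' w = dist a x := by
    rw [← hiso a' ha', hFa, hw, T.dist_sheet hT b (openTri_subset_closedTri hT ha) hx]
  obtain ⟨g, hg, hga⟩ := hF.exists_lift_of_mem_openTri hT ha hFa
  refine ⟨g, hg, ?_⟩
  have hgx : g x ∈ Metric.ball w ε := by
    rw [Metric.mem_ball]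
    have h1 := dist_triangle (g x) (g a) w
    rw [g.isometry.dist_eq, hga, hd, dist_comm a x] at h1
    linarith
  rw [← dist_eq_zero, ← hiso _ hgx, hg x hx, hw, dist_self]

/-- Lifts of a sheet that agree at an interior point are equal. -/
theorem isLift_unique {b : Bool} {g g' : ℍ ≃ᵢ ℍ} (hg : IsLift F hT b g) (hg' : IsLift F hT b g')
    {x : ℍ} (hx : x ∈ openTri hT) (h : g x = g' x) : g = g' := by
  have hFx := hg x (openTri_subset_closedTri hT hx)
  obtain ⟨ε, hε, -, hiso⟩ := hF.exists_local_isometry (z := g x)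
    (by rw [hFx]; exact T.sheet_ne_conePt_of_mem_openTri hT hx)
  obtain ⟨a, haN, ha⟩ := exists_linearIndependent_hyp
    (Metric.isOpen_ball.inter (isOpen_openTri hT)) ⟨x, Metric.mem_ball_self hε, hx⟩
  have hag : ∀ i, g' (a i) = g (a i) := by
    intro i
    have haT := openTri_subset_closedTri hT (haN i).2
    have hai : dist (a i) x < ε := (haN i).1
    rw [← dist_eq_zero, ← hiso _ (by rwa [Metric.mem_ball, h, g'.isometry.dist_eq]) _
      (by rwa [Metric.mem_ball, g.isometry.dist_eq]), hg _ haT, hg' _ haT, dist_self]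
  ext1 c
  refine (eq_of_dist_eq_image ha g' fun i => ?_)
  rw [hag, g.isometry.dist_eq]

end IsBranchedDevelopment

/-! ### Preimages of the cone points -/

section Sheets

variable {p q r : ℕ} (T : HypTriangle p q r) (hT : LinearIndependent ℝ fun i => hyp (T.pt i))

include hT in
theorem HypTriangle.dist_conePt (i j : Fin 3) :
    dist (T.conePt i) (T.conePt j) = dist (T.pt i) (T.pt j) :=
  T.dist_sheet hT true (vertex_mem_closedTri hT i) (vertex_mem_closedTri hT j)

include hT in
theorem HypTriangle.conePt_injective : Function.Injective T.conePt := fun i j h => by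
  apply vertex_injective hT
  rw [← dist_eq_zero, ← T.dist_conePt hT, h, dist_self]

/-- Near a point of a sheet, only sheets through that point are met. -/
theorem HypTriangle.exists_ball_sheet (b : Bool) {y : ℍ} (hy : y ∈ closedTri hT) :
    ∃ δ > 0, ∀ Q ∈ Metric.ball (T.sheet b y) δ, ∃ b', ∃ x ∈ closedTri hT,
      T.sheet b' x = Q ∧ T.sheet b' y = T.sheet b y := by
  by_cases h : ∃ k, bary hT k y = 0
  · obtain ⟨k, hk⟩ := h
    refine ⟨1, one_pos, fun Q _ => ?_⟩
    obtain ⟨b', x, hx, rfl⟩ := T.exists_sheet_eq hT Q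
    exact ⟨b', x, hx, rfl, T.sheet_eq_sheet hT _ _ hy hk⟩
  · push Not at h
    have hy' : y ∈ openTri hT := fun k => lt_of_le_of_ne (hy k) (h k).symm
    obtain ⟨δ, hδ, hball⟩ := Metric.isOpen_iff.1 (T.isOpen_sheet_image hT b) _ ⟨y, hy', rfl⟩
    refine ⟨δ, hδ, fun Q hQ => ?_⟩
    obtain ⟨x, hx, rfl⟩ := hball hQ
    exact ⟨b, x, openTri_subset_closedTri hT hx, rfl, rfl⟩

end Sheets

namespace IsBranchedDevelopment

variable {p q r : ℕ} {T : HypTriangle p q r} {F : ℍ → T.Turnover} (hF : IsBranchedDevelopment F)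
  (hT : LinearIndependent ℝ fun i => hyp (T.pt i)) (hn : ∀ y, T.coneOrder y ≠ 0)

include hF

theorem dist_conePt_le {i : Fin 3} {z : ℍ} (hz : F z = T.conePt i) (m : ℍ) :
    dist (T.conePt i) (F m) ≤ dist z m := by
  rw [← hz]; exact hF.dist_le z m

include hn

/-- The preimage of a point is discrete and closed. -/
theorem finite_fiber_inter_closedBall (y : T.Turnover) (z : ℍ) (R : ℝ) :
    (F ⁻¹' {y} ∩ Metric.closedBall z R).Finite := by
  rw [Set.inter_comm]
  refine (isCompact_closedBall z R).induction_on (p := fun s => (s ∩ F ⁻¹' {y}).Finite) (by simp)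
    (fun s t hst ht => ht.subset (Set.inter_subset_inter_left _ hst))
    (fun s t hs ht => by rw [Set.union_inter_distrib_right]; exact hs.union ht) ?_
  intro w _
  by_cases hw : F w = y
  · obtain ⟨ε, hε, -, h⟩ := hF.exists_ball_dist_center hn w
    refine ⟨Metric.ball w ε, mem_nhdsWithin_of_mem_nhds (Metric.ball_mem_nhds w hε),
      (Set.finite_singleton w).subset ?_⟩
    rintro a ⟨ha, hay⟩
    have hay' : F a = y := hay
    rw [Set.mem_singleton_iff, ← dist_eq_zero, ← h a ha, hay', hw, dist_self]
  · refine ⟨{a | F a ≠ y}, mem_nhdsWithin_of_mem_nhds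
      ((isOpen_ne_fun hF.continuous continuous_const).mem_nhds hw), ?_⟩
    convert! Set.finite_empty
    ext a
    simp

include hT in
/-- The distance to a cone point in the turnover is the distance to its preimage. -/
theorem exists_dist_eq_dist_conePt (i : Fin 3) (m : ℍ) :
    ∃ z, F z = T.conePt i ∧ dist z m = dist (T.conePt i) (F m) := by
  obtain ⟨b, y, hy, hb⟩ := T.exists_sheet_eq hT (F m)
  obtain ⟨g, hg, hgy⟩ := hF.exists_lift hT hn hy hb.symm
  refine ⟨g (T.pt i), ?_, ?_⟩
  · rw [hg _ (vertex_mem_closedTri hT i), T.sheet_pt hT]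
  · rw [← hgy, g.isometry.dist_eq, hg y hy, T.dist_conePt_sheet hT i hy]

include hT in
/-- Distinct preimages of a cone point are further apart than the diameter of the circles about
them: the midpoint `m` of a shortest arc between two of them would be the end of a single radial
segment in the turnover, yet both halves of the arc map into that segment. -/
theorem eq_of_dist_le {i : Fin 3} {z z' : ℍ} (hz : F z = T.conePt i) (hz' : F z' = T.conePt i)
    (hd : dist z z' ≤ 2 * triRadius T.pt i) : z = z' := by
  by_contra hne
  set D : Set ℍ := {u | F u = T.conePt i ∧ u ≠ z ∧ dist z u ≤ 2 * triRadius T.pt i} with hD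
  have hDfin : D.Finite := (hF.finite_fiber_inter_closedBall hn (T.conePt i) z
    (2 * triRadius T.pt i)).subset fun u hu => ⟨hu.1, by
      rw [Metric.mem_closedBall, dist_comm]; exact hu.2.2⟩
  obtain ⟨u, ⟨huF, huz, hud⟩, hmin⟩ := Set.exists_min_image D (dist z) hDfin
    ⟨z', hz', Ne.symm hne, hd⟩
  obtain ⟨γ, hγ, h0, h1⟩ := exists_geodesic huz.symm
  set d := dist z u with hdd
  have hd0 : 0 < d := dist_pos.2 huz.symm
  set m := γ (d / 2) with hm
  have hγd : ∀ s t : ℝ, s ≤ t → dist (γ s) (γ t) = t - s := fun s t hst => by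
    rw [hγ.dist_eq, Real.dist_eq, abs_sub_comm, abs_of_nonneg (by linarith)]
  have hzm : dist z m = d / 2 := by
    rw [← h0, hγd _ _ (by positivity)]; ring
  have hmu : dist m u = d / 2 := by
    rw [← h1, hγd _ _ (by linarith)]; ring
  have hFm : dist (T.conePt i) (F m) = d / 2 := by
    apply le_antisymm
    · rw [← hzm]; exact hF.dist_conePt_le hz m
    · obtain ⟨v, hv, hvm⟩ := hF.exists_dist_eq_dist_conePt hT hn i m
      rw [← hvm]
      by_cases hvz : v = z
      · rw [hvz, hzm]
      · by_contra hlt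
        push Not at hlt
        have htri := dist_triangle z m v
        rw [hzm, dist_comm m v] at htri
        have hvD : v ∈ D := ⟨hv, hvz, by linarith⟩
        linarith [hmin v hvD]
  obtain ⟨b, y, hy, hb⟩ := T.exists_sheet_eq hT (F m)
  have hyd : dist (T.pt i) y = d / 2 := by rw [← T.dist_conePt_sheet hT i hy (b := b), hb, hFm]
  have hyi := bary_pos_of_dist_le hT hy (by linarith : dist (T.pt i) y ≤ triRadius T.pt i)
  have hmc : ∀ j, F m ≠ T.conePt j := by
    intro j hj
    rw [hj, T.dist_conePt hT] at hFm
    by_cases hij : i = j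
    · rw [hij, dist_self] at hFm
      linarith
    · rw [← triRadius_add _ hij] at hFm
      linarith [triRadius_pos hT j]
  obtain ⟨ε, hε, -, hiso⟩ := hF.exists_local_isometry hmc
  obtain ⟨δ, hδ, hsheet⟩ := T.exists_ball_sheet hT b hy
  obtain ⟨s, hs0, hs⟩ := exists_between (lt_min (lt_min hε hδ) (half_pos hd0))
  have hsε : s < ε := hs.trans_le ((min_le_left _ _).trans (min_le_left _ _))
  have hsδ : s < δ := hs.trans_le ((min_le_left _ _).trans (min_le_right _ _))
  have hsd : s < d / 2 := hs.trans_le (min_le_right _ _)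
  -- a point at distance `s` from `m` towards `z` or `u` maps to the radial segment through `F m`
  have key : ∀ c v, F v = T.conePt i → dist v c = d / 2 - s → dist c m = s →
      ∃ b', ∃ x ∈ closedTri hT, T.sheet b' x = F c ∧ T.sheet b' y = F m ∧
        x ∈ hypSegment (T.pt i) y ∧ dist (T.pt i) x = d / 2 - s := by
    intro c v hv hvc hcm
    have hFcm : dist (F c) (F m) = s := by
      rw [hiso c (by rw [Metric.mem_ball, hcm]; exact hsε) m (Metric.mem_ball_self hε), hcm]
    obtain ⟨b', x, hx, hxc, hb'⟩ := hsheet (F c) (by rw [Metric.mem_ball, hb, hFcm]; exact hsδ)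
    have hxd : dist (T.pt i) x = dist (T.conePt i) (F c) := by
      rw [← hxc, T.dist_conePt_sheet hT i hx]
    have hxy : dist x y = s := by
      rw [← T.dist_sheet hT b' hx hy, hxc, hb', hb, hFcm]
    have h2 := hF.dist_conePt_le hv c
    have h3 := dist_triangle (T.pt i) x y
    have h4 : dist (T.pt i) x = d / 2 - s := by
      apply le_antisymm <;> linarith
    refine ⟨b', x, hx, hxc, hb'.trans hb, ?_, h4⟩
    change dist (T.pt i) x + dist x y = dist (T.pt i) y
    linarith
  have e1 : dist (γ (d / 2 - s)) m = s := by rw [hγd _ _ (by linarith)]; ring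
  have e2 : dist (γ (d / 2 + s)) m = s := by
    rw [dist_comm, hγd _ _ (by linarith)]; ring
  obtain ⟨b1, x1, hx1, hF1, hy1, hseg1, hd1⟩ := key (γ (d / 2 - s)) z hz
    (by rw [← h0, hγd _ _ (by linarith)]; ring) e1
  obtain ⟨b2, x2, hx2, hF2, hy2, hseg2, hd2⟩ := key (γ (d / 2 + s)) u huF
    (by rw [dist_comm, ← h1, hγd _ _ (by linarith)]; ring) e2
  have hx12 : x1 = x2 := eq_of_mem_hypSegment hseg1 hseg2 (hd1.trans hd2.symm)
  have hFF : F (γ (d / 2 - s)) = F (γ (d / 2 + s)) := by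
    rw [← hF1, ← hF2, ← hx12]
    obtain ⟨-, rfl | ⟨k, hk⟩⟩ := T.eq_of_sheet_eq hT hy hy (hy1.trans hy2.symm)
    · rfl
    · -- `y` lies on a side through the vertex `i`, and so does the whole radial segment
      have hki : k ≠ i := by rintro rfl; exact hyi.ne' hk
      apply T.sheet_eq_sheet hT _ _ hx1 (k := k)
      refine bary_eq_zero_of_mem_hypSegment hT ?_ hk hseg1
      rw [bary_vertex, if_neg hki]
  have h5 := hiso _ (by rw [Metric.mem_ball, e1]; exact hsε : γ (d / 2 - s) ∈ Metric.ball m ε) _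
    (by rw [Metric.mem_ball, e2]; exact hsε : γ (d / 2 + s) ∈ Metric.ball m ε)
  rw [hFF, dist_self, hγd _ _ (by linarith)] at h5
  linarith

end IsBranchedDevelopment

/-! ### The deck group -/

theorem proj_eq_proj_iff {Γ : Subgroup PSL2R} {z w : ℍ} :
    proj Γ z = proj Γ w ↔ ∃ γ ∈ lift Γ, γ • w = z := by
  rw [proj, proj, Quotient.eq'', MulAction.orbitRel_apply, MulAction.mem_orbit_iff]
  constructor
  · rintro ⟨γ, h⟩; exact ⟨γ, γ.2, h⟩
  · rintro ⟨γ, hγ, h⟩; exact ⟨⟨γ, hγ⟩, h⟩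

theorem proj_smul {Γ : Subgroup PSL2R} {γ : SL(2, ℝ)} (hγ : γ ∈ lift Γ) (z : ℍ) :
    proj Γ (γ • z) = proj Γ z := proj_eq_proj_iff.2 ⟨γ, hγ, rfl⟩

theorem proj_surjective (Γ : Subgroup PSL2R) : Function.Surjective (proj Γ) :=
  Quotient.mk''_surjective

theorem continuous_proj (Γ : Subgroup PSL2R) : Continuous (proj Γ) := continuous_quotient_mk'

theorem isOpenMap_proj (Γ : Subgroup PSL2R) : IsOpenMap (proj Γ) :=
  isOpenMap_quotient_mk'_mul

/-- An element of `SL(2, ℝ)` with two fixed points in `ℍ` is central: its fixed points are roots of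
a real quadratic polynomial, of which `ℍ` contains at most one unless the polynomial vanishes. -/
theorem mem_center_of_smul_eq {γ : SL(2, ℝ)} {z w : ℍ} (hzw : z ≠ w) (hz : γ • z = z)
    (hw : γ • w = w) : γ ∈ Subgroup.center SL(2, ℝ) := by
  have key : ∀ z : ℍ, γ • z = z → γ 1 1 - γ 0 0 = -2 * γ 1 0 * z.re ∧
      γ 0 1 = -γ 1 0 * (z.re ^ 2 + z.im ^ 2) := by
    intro z hz
    have h := congrArg UpperHalfPlane.coe hz
    rw [UpperHalfPlane.coe_specialLinearGroup_apply] at h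
    have hden : ((γ 1 0 : ℝ) : ℂ) * z + (γ 1 1 : ℝ) ≠ 0 :=
      UpperHalfPlane.denom_ne_zero (γ : GL (Fin 2) ℝ) z
    simp only [Algebra.algebraMap_self, RingHom.id_apply] at h
    rw [div_eq_iff hden] at h
    have hre := congrArg Complex.re h
    have him := congrArg Complex.im h
    simp at hre him
    have hy := z.im_pos
    have e1 : γ 1 1 - γ 0 0 = -2 * γ 1 0 * z.re := by
      apply mul_right_cancel₀ hy.ne'
      linear_combination -him
    refine ⟨e1, ?_⟩
    linear_combination hre + z.re * e1
  obtain ⟨z1, z2⟩ := key z hz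
  obtain ⟨w1, w2⟩ := key w hw
  have hc : γ 1 0 = 0 := by
    by_contra hc
    apply hzw
    have hre : z.re = w.re := by
      have : γ 1 0 * (z.re - w.re) = 0 := by linarith
      linarith [(mul_eq_zero.1 this).resolve_left hc]
    refine UpperHalfPlane.ext_re_im hre ?_
    rw [hre] at z2
    have : γ 1 0 * (z.im ^ 2 - w.im ^ 2) = 0 := by linarith
    have h2 := (mul_eq_zero.1 this).resolve_left hc
    exact (sq_eq_sq₀ z.im_pos.le w.im_pos.le).1 (by linarith)
  rw [hc] at z1 z2
  have hd : γ 1 1 = γ 0 0 := by linarith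
  have hb : γ 0 1 = 0 := by linarith
  have hdet := Matrix.det_fin_two (γ : Matrix (Fin 2) (Fin 2) ℝ)
  rw [γ.det_coe] at hdet
  rw [Matrix.SpecialLinearGroup.mem_center_iff]
  refine ⟨γ 0 0, ?_, ?_⟩
  · simp only [Fintype.card_fin]
    have hc' : (γ : Matrix (Fin 2) (Fin 2) ℝ) 1 0 = 0 := hc
    have hd' : (γ : Matrix (Fin 2) (Fin 2) ℝ) 1 1 = (γ : Matrix (Fin 2) (Fin 2) ℝ) 0 0 := hd
    rw [hc', hd'] at hdet
    change (γ : Matrix (Fin 2) (Fin 2) ℝ) 0 0 ^ 2 = 1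
    linarith
  · ext i j
    fin_cases i <;> fin_cases j
    · simp
    · simpa using hb.symm
    · simpa using hc.symm
    · simpa using hd.symm

theorem smul_eq_of_mem_center {γ : SL(2, ℝ)} (h : γ ∈ Subgroup.center SL(2, ℝ)) (w : ℍ) :
    γ • w = w := by
  obtain ⟨c, hc, h⟩ := Matrix.SpecialLinearGroup.mem_center_iff.1 h
  have hc0 : (c : ℂ) ≠ 0 := by
    intro h0
    have h0' : c = 0 := by exact_mod_cast h0
    rw [h0'] at hc
    simp at hc
  apply UpperHalfPlane.coe_injective
  rw [UpperHalfPlane.coe_specialLinearGroup_apply, ← h]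
  simp
  field_simp

/-- In a torsion-free group of deck transformations an element that fixes a point acts trivially:
its powers move any further point `b` within a finite part of a fibre of `F`, so some positive power
fixes `b` as well and is central. -/
theorem IsBranchedDevelopment.smul_eq_of_smul_eq {p q r : ℕ} {T : HypTriangle p q r}
    {F : ℍ → T.Turnover} (hF : IsBranchedDevelopment F) (hn : ∀ y, T.coneOrder y ≠ 0)
    {Γ : Subgroup PSL2R} (hΓ : ∀ γ ∈ Γ, IsOfFinOrder γ → γ = 1)
    (hinv : ∀ γ ∈ lift Γ, ∀ z, F (γ • z) = F z) {γ : SL(2, ℝ)} (hγ : γ ∈ lift Γ) {z : ℍ}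
    (hz : γ • z = z) (w : ℍ) : γ • w = w := by
  obtain ⟨b, hb⟩ : ∃ b, b ≠ z := by
    obtain ⟨a, -, ha⟩ := exists_linearIndependent_hyp isOpen_univ ⟨z, trivial⟩
    by_contra hall
    push Not at hall
    have := vertex_injective ha ((hall (a 0)).trans (hall (a 1)).symm)
    simp at this
  have hpow : ∀ k : ℕ, γ ^ k • z = z := by
    intro k
    induction k with
    | zero => simp
    | succ k ih => rw [pow_succ, mul_smul, hz, ih]
  have hfin := hF.finite_fiber_inter_closedBall hn (F b) z (dist b z)
  have hmem : ∀ k : ℕ, γ ^ k • b ∈ F ⁻¹' {F b} ∩ Metric.closedBall z (dist b z) := by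
    intro k
    refine ⟨hinv _ ((lift Γ).pow_mem hγ k) b, ?_⟩
    rw [Metric.mem_closedBall]
    nth_rewrite 1 [← hpow k]
    rw [dist_smul]
  have hninj : ¬ Function.Injective fun k : ℕ => γ ^ k • b := fun hinj =>
    Set.infinite_range_of_injective hinj (hfin.subset (Set.range_subset_iff.2 hmem))
  rw [Function.Injective] at hninj
  push Not at hninj
  obtain ⟨k, l, hkl, hne⟩ := hninj
  wlog hlt : k < l generalizing k l
  · exact this l k hkl.symm hne.symm (by omega)
  obtain ⟨n, rfl⟩ := Nat.exists_eq_add_of_lt hlt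
  have hfix : γ ^ (n + 1) • b = b := by
    have : γ ^ k • b = γ ^ k • γ ^ (n + 1) • b := by
      rw [smul_smul, ← pow_add]; exact hkl
    exact (smul_left_cancel _ this).symm
  have hcen := mem_center_of_smul_eq hb hfix (hpow (n + 1))
  have hone : (QuotientGroup.mk' (Subgroup.center SL(2, ℝ)) γ) = 1 := by
    apply hΓ _ hγ
    rw [isOfFinOrder_iff_pow_eq_one]
    refine ⟨n + 1, by omega, ?_⟩
    rw [← map_pow]
    exact (QuotientGroup.eq_one_iff _).2 hcen
  exact smul_eq_of_mem_center ((QuotientGroup.eq_one_iff _).1 hone) w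

/-! ### Lifted sides -/

theorem exists_third (i j : Fin 3) : ∃ k, k ≠ i ∧ k ≠ j := by
  revert i j; decide

theorem exists_opposite_side (k : Fin 3) :
    ∃ i j : Fin 3, i ≠ j ∧ k ≠ i ∧ k ≠ j ∧ ∀ l, l ≠ i → l ≠ j → l = k := by
  revert k; decide

namespace IsBranchedDevelopment

variable {p q r : ℕ} {T : HypTriangle p q r} {F : ℍ → T.Turnover} (hF : IsBranchedDevelopment F)
  (hT : LinearIndependent ℝ fun i => hyp (T.pt i))

include hF hT

/-- An arc that joins preimages of two cone points and has the length of the side between them maps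
isometrically onto that side. -/
theorem exists_side_point {i j : Fin 3} (hij : i ≠ j) {z z' w : ℍ} (hz : F z = T.conePt i)
    (hz' : F z' = T.conePt j) (hd : dist z z' = dist (T.pt i) (T.pt j))
    (hw : w ∈ hypSegment z z') : ∃ y ∈ hypSegment (T.pt i) (T.pt j),
      (∀ b, F w = T.sheet b y) ∧ dist (T.pt i) y = dist z w := by
  obtain ⟨b, y, hy, hb⟩ := T.exists_sheet_eq hT (F w)
  have h1 := hF.dist_conePt_le hz w
  have h2 := hF.dist_conePt_le hz' w
  rw [← hb, T.dist_conePt_sheet hT _ hy] at h1 h2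
  have h3 : dist z w + dist w z' = dist z z' := hw
  have h4 := dist_triangle (T.pt i) y (T.pt j)
  rw [dist_comm (T.pt j) y, dist_comm z' w] at h2
  have hmem : y ∈ hypSegment (T.pt i) (T.pt j) := by
    change dist (T.pt i) y + dist y (T.pt j) = dist (T.pt i) (T.pt j)
    linarith
  refine ⟨y, hmem, fun b' => ?_, by linarith⟩
  obtain ⟨k, hki, hkj⟩ := exists_third i j
  rw [← hb]
  exact T.sheet_eq_sheet hT _ _ hy (((mem_hypSegment_vertices_iff hT hij).1 hmem).2 k hki hkj)

/-- A lifted side contains no preimages of cone points besides its endpoints. -/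
theorem conePt_iff_of_mem_side {i j : Fin 3} (hij : i ≠ j) {z z' w : ℍ} (hz : F z = T.conePt i)
    (hz' : F z' = T.conePt j) (hd : dist z z' = dist (T.pt i) (T.pt j))
    (hw : w ∈ hypSegment z z') : (∃ l, F w = T.conePt l) ↔ w = z ∨ w = z' := by
  constructor
  · rintro ⟨l, hl⟩
    obtain ⟨y, hy, hFy, hyd⟩ := hF.exists_side_point hT hij hz hz' hd hw
    have hyT := ((mem_hypSegment_vertices_iff hT hij).1 hy)
    have hyl : y = T.pt l := (T.eq_of_sheet_eq hT hyT.1 (vertex_mem_closedTri hT l)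
      ((hFy true).symm.trans hl)).1
    have hl' : l = i ∨ l = j := by
      by_contra hn
      push Not at hn
      have := hyT.2 l hn.1 hn.2
      rw [hyl, bary_vertex] at this
      simp at this
    rcases hl' with rfl | rfl
    · left
      rw [hyl, dist_self] at hyd
      exact (dist_eq_zero.1 hyd.symm).symm
    · right
      have h3 : dist z w + dist w z' = dist z z' := hw
      rw [← hyd, hyl, hd] at h3
      exact dist_eq_zero.1 (by linarith)
  · rintro (rfl | rfl)
    · exact ⟨i, hz⟩
    · exact ⟨j, hz'⟩

/-- Two lifts of the same side that meet away from the vertices start at the same vertex. -/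
theorem eq_of_mem_sides {i j : Fin 3} (hij : i ≠ j) {z z' u u' w : ℍ} (hz : F z = T.conePt i)
    (hz' : F z' = T.conePt j) (hd : dist z z' = dist (T.pt i) (T.pt j))
    (hu : F u = T.conePt i) (hu' : F u' = T.conePt j) (hud : dist u u' = dist (T.pt i) (T.pt j))
    (hw : w ∈ hypSegment z z') (hw' : w ∈ hypSegment u u') (hwc : ∀ l, F w ≠ T.conePt l) :
    z = u := by
  obtain ⟨ε, hε, -, hiso⟩ := hF.exists_local_isometry hwc
  obtain ⟨y, hy, hFy, hyd⟩ := hF.exists_side_point hT hij hz hz' hd hw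
  obtain ⟨y', hy', hFy', hyd'⟩ := hF.exists_side_point hT hij hu hu' hud hw'
  have hyy : y = y' := (T.eq_of_sheet_eq hT ((mem_hypSegment_vertices_iff hT hij).1 hy).1
    ((mem_hypSegment_vertices_iff hT hij).1 hy').1 ((hFy true).symm.trans (hFy' true))).1
  subst hyy
  set t := dist (T.pt i) y with ht
  have ht0 : 0 < t := by
    rw [hyd]
    refine dist_pos.2 ?_
    rintro rfl
    exact hwc i hz
  obtain ⟨s, hs0, hs⟩ := exists_between (lt_min hε ht0)
  have hsε := hs.trans_le (min_le_left _ _)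
  have hst := hs.trans_le (min_le_right _ _)
  -- the point at distance `s` from `w` towards the vertex `v` of the lifted side from `v` to `v'`
  have key : ∀ v v', F v = T.conePt i → F v' = T.conePt j →
      dist v v' = dist (T.pt i) (T.pt j) → w ∈ hypSegment v v' → t = dist v w →
      ∃ c ∈ hypSegment v w, dist v c = t - s ∧ dist c w = s ∧
        ∃ x ∈ hypSegment (T.pt i) (T.pt j), F c = T.sheet true x ∧ dist (T.pt i) x = t - s := by
    intro v v' hv hv' hvd hwv htv
    have hvw : v ≠ w := by
      rintro rfl
      rw [dist_self] at htv
      linarith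
    obtain ⟨γ, hγ, h0, h1⟩ := exists_geodesic hvw
    rw [← htv] at h1
    have e1 : dist v (γ (t - s)) = t - s := by
      rw [← h0, hγ.dist_eq, Real.dist_eq, zero_sub, abs_neg, abs_of_pos (by linarith)]
    have e2 : dist (γ (t - s)) w = s := by
      rw [← h1, hγ.dist_eq, Real.dist_eq, abs_sub_comm, abs_of_pos (by linarith)]; ring
    have e3 : dist v w + dist w v' = dist v v' := hwv
    have hcv : γ (t - s) ∈ hypSegment v v' := by
      change dist v (γ (t - s)) + dist (γ (t - s)) v' = dist v v'
      have h4 := dist_triangle v (γ (t - s)) v'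
      have h5 := dist_triangle (γ (t - s)) w v'
      linarith
    obtain ⟨x, hx, hFx, hxd⟩ := hF.exists_side_point hT hij hv hv' hvd hcv
    refine ⟨γ (t - s), ?_, e1, e2, x, hx, hFx true, hxd.trans e1⟩
    change dist v (γ (t - s)) + dist (γ (t - s)) w = dist v w
    linarith
  obtain ⟨c, hc, hzc, hcw, x, hx, hFx, hxd⟩ := key z z' hz hz' hd hw hyd
  obtain ⟨c', hc', hzc', hcw', x', hx', hFx', hxd'⟩ := key u u' hu hu' hud hw' hyd'
  have hxx : x = x' := eq_of_mem_hypSegment hx hx' (hxd.trans hxd'.symm)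
  have hcc : c = c' := by
    rw [← dist_eq_zero, ← hiso c (by rw [Metric.mem_ball, hcw]; exact hsε) c'
      (by rw [Metric.mem_ball, hcw']; exact hsε), hFx, hFx', hxx, dist_self]
  subst hcc
  refine eq_of_mem_hypSegment_of_ne hc hc' (hzc.trans hzc'.symm) ?_
  rintro rfl
  rw [dist_self] at hcw
  linarith

end IsBranchedDevelopment

theorem image_hypSegment (g : ℍ ≃ᵢ ℍ) (a b : ℍ) :
    g '' hypSegment a b = hypSegment (g a) (g b) := by
  ext w
  constructor
  · rintro ⟨c, hc, rfl⟩
    simpa only [hypSegment, Set.mem_ofPred_eq, g.isometry.dist_eq] using hc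
  · intro hw
    obtain ⟨c, rfl⟩ := g.surjective w
    refine ⟨c, ?_, rfl⟩
    simpa only [hypSegment, Set.mem_ofPred_eq, g.isometry.dist_eq] using hw

theorem proj_image_hypSegment_smul {Γ : Subgroup PSL2R} {γ : SL(2, ℝ)} (hγ : γ ∈ lift Γ)
    (a b : ℍ) : proj Γ '' hypSegment (γ • a) (γ • b) = proj Γ '' hypSegment a b := by
  have := image_hypSegment (IsometryEquiv.constSMul γ) a b
  simp only [IsometryEquiv.constSMul_apply] at this
  rw [← this, Set.image_image]
  simp only [proj_smul hγ]

/-! ### The packing of the surface -/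

section Packing

variable {Γ : Subgroup PSL2R} {p q r : ℕ} {T : HypTriangle p q r} {f : Surface Γ → T.Turnover}
  (hf : IsBranchedCover f) (hT : LinearIndependent ℝ fun i => hyp (T.pt i))
  (hn : ∀ y, T.coneOrder y ≠ 0) (hΓ : ∀ γ ∈ Γ, IsOfFinOrder γ → γ = 1)

include hf in
theorem IsBranchedCover.development : IsBranchedDevelopment fun z => f (proj Γ z) := hf

include hf in
theorem IsBranchedCover.continuous : Continuous f :=
  continuous_coinduced_dom.2 hf.development.continuous

/-- The circles of the packing: about each preimage of a cone point, with the radius of the circle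
at the corresponding vertex in the triple of mutually tangent circles of the triangle. -/
def liftedCircles (f : Surface Γ → T.Turnover) : Set (GeodesicCircle Γ) :=
  {c | ∃ i, f c.center = T.conePt i ∧ c.radius = triRadius T.pt i}

include hf hT hn hΓ in
theorem exists_liftedCircle {i : Fin 3} {z : ℍ} (hz : f (proj Γ z) = T.conePt i) :
    ∃ c ∈ liftedCircles f, c.center = proj Γ z ∧ c.radius = triRadius T.pt i := by
  refine ⟨⟨proj Γ z, triRadius T.pt i, triRadius_pos hT i, ?_⟩, ⟨i, hz, rfl⟩, rfl, rfl⟩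
  intro u hu a ha b hb hab
  obtain ⟨γ, hγ, rfl⟩ := proj_eq_proj_iff.1 hab
  rw [Metric.mem_closedBall] at ha hb
  have hFu : f (proj Γ u) = T.conePt i := by rw [hu, hz]
  have hd : dist u (γ • u) ≤ 2 * triRadius T.pt i := by
    have h1 := dist_triangle_left u (γ • u) (γ • b)
    rw [dist_smul] at h1
    linarith
  have hfix := hf.development.eq_of_dist_le hT hn hFu
    (by simpa only [proj_smul hγ] using hFu) hd
  exact hf.development.smul_eq_of_smul_eq hn hΓ
    (fun γ hγ z => by simp only [proj_smul hγ]) hγ hfix.symm b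

include hf hT hn in
theorem disjoint_interior_liftedCircles {c c' : GeodesicCircle Γ} (hc : c ∈ liftedCircles f)
    (hc' : c' ∈ liftedCircles f) (hne : c ≠ c') : Disjoint c.interior c'.interior := by
  obtain ⟨i, hci, hri⟩ := hc
  obtain ⟨j, hcj, hrj⟩ := hc'
  rw [Set.disjoint_left]
  rintro s ⟨z, hz, a, ha, rfl⟩ ⟨z', hz', a', ha', haa⟩
  obtain ⟨γ, hγ, rfl⟩ := proj_eq_proj_iff.1 haa.symm
  rw [Metric.mem_ball] at ha ha'
  rw [hri] at ha
  rw [hrj] at ha'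
  have hFz : f (proj Γ z) = T.conePt i := by rw [hz, hci]
  have hFz' : f (proj Γ (γ • z')) = T.conePt j := by rw [proj_smul hγ, hz', hcj]
  have hd : dist z (γ • z') < triRadius T.pt i + triRadius T.pt j := by
    have h1 := dist_triangle_left z (γ • z') (γ • a')
    rw [dist_smul] at h1
    linarith
  by_cases hij : i = j
  · subst hij
    have hzz := hf.development.eq_of_dist_le hT hn hFz hFz' (by linarith)
    apply hne
    have hcc : c.center = c'.center := by rw [← hz, ← hz', hzz, proj_smul hγ]
    have hrr : c.radius = c'.radius := hri.trans hrj.symm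
    cases c
    cases c'
    simp only at hcc hrr
    subst hcc hrr
    rfl
  · rw [triRadius_add _ hij, ← T.dist_conePt hT, ← hFz'] at hd
    exact absurd (hf.development.dist_conePt_le hFz (γ • z')) (not_le.2 hd)

include hf hT hn hΓ in
theorem packingVertices_liftedCircles :
    packingVertices (liftedCircles f) = {s | ∃ i, f s = T.conePt i} := by
  ext s
  constructor
  · rintro ⟨c, ⟨i, hi, -⟩, rfl⟩
    exact ⟨i, hi⟩
  · rintro ⟨i, hi⟩
    obtain ⟨z, rfl⟩ := proj_surjective Γ s
    obtain ⟨c, hc, hcz, -⟩ := exists_liftedCircle hf hT hn hΓ hi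
    exact ⟨c, hc, hcz⟩

/-- Circles of the packing that are tangent lie over different cone points, so that the edges of the
packing graph are the lifts of the sides of the triangle. -/
theorem mem_packingEdges_liftedCircles (hf : IsBranchedCover f)
    (hT : LinearIndependent ℝ fun i => hyp (T.pt i)) (hn : ∀ y, T.coneOrder y ≠ 0)
    (hΓ : ∀ γ ∈ Γ, IsOfFinOrder γ → γ = 1) {e : Set (Surface Γ)} :
    e ∈ packingEdges (liftedCircles f) ↔ ∃ i j, i ≠ j ∧ ∃ z z', f (proj Γ z) = T.conePt i ∧
      f (proj Γ z') = T.conePt j ∧ dist z z' = dist (T.pt i) (T.pt j) ∧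
      e = proj Γ '' hypSegment z z' := by
  constructor
  · rintro ⟨c, ⟨i, hci, hri⟩, c', ⟨j, hcj, hrj⟩, -, z, z', hz, hz', hd, rfl⟩
    rw [← hz] at hci
    rw [← hz'] at hcj
    rw [hri, hrj] at hd
    have hij : i ≠ j := by
      rintro rfl
      have hzz := hf.development.eq_of_dist_le hT hn hci hcj (by linarith)
      rw [hzz, dist_self] at hd
      linarith [triRadius_pos hT i]
    exact ⟨i, j, hij, z, z', hci, hcj, hd.trans (triRadius_add _ hij), rfl⟩
  · rintro ⟨i, j, hij, z, z', hz, hz', hd, rfl⟩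
    obtain ⟨c, hc, hcz, hcr⟩ := exists_liftedCircle hf hT hn hΓ hz
    obtain ⟨c', hc', hcz', hcr'⟩ := exists_liftedCircle hf hT hn hΓ hz'
    refine ⟨c, hc, c', hc', ?_, z, z', hcz.symm, hcz'.symm, ?_, rfl⟩
    · rintro rfl
      apply hij
      apply T.conePt_injective hT
      rw [← hz, ← hz', ← hcz, ← hcz']
    · rw [hd, hcr, hcr', triRadius_add _ hij]

end Packing

/-! ### The packing graph triangulates the surface -/

section Triangulation

variable {Γ : Subgroup PSL2R} {p q r : ℕ} {T : HypTriangle p q r} {f : Surface Γ → T.Turnover}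
  (hf : IsBranchedCover f) (hT : LinearIndependent ℝ fun i => hyp (T.pt i))
  (hn : ∀ y, T.coneOrder y ≠ 0) (hΓ : ∀ γ ∈ Γ, IsOfFinOrder γ → γ = 1)

include hf hT hn hΓ in
theorem edge_arc_liftedCircles {e : Set (Surface Γ)} (he : e ∈ packingEdges (liftedCircles f)) :
    ∃ γ : unitInterval → Surface Γ, Topology.IsEmbedding γ ∧ Set.range γ = e ∧
      ∀ t, γ t ∈ packingVertices (liftedCircles f) ↔ t = 0 ∨ t = 1 := by
  obtain ⟨i, j, hij, z, z', hz, hz', hd, rfl⟩ := (mem_packingEdges_liftedCircles hf hT hn hΓ).1 he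
  have hne : z ≠ z' := by
    rintro rfl
    exact hij (T.conePt_injective hT (hz.symm.trans hz'))
  obtain ⟨γ, hγ, h0, h1⟩ := exists_geodesic hne
  have hd0 := dist_pos.2 hne
  have hc : ∀ t : unitInterval, dist z (γ (t * dist z z')) = t * dist z z' := fun t => by
    have ht : (0 : ℝ) ≤ t * dist z z' := mul_nonneg t.2.1 hd0.le
    nth_rewrite 1 [← h0]
    rw [hγ.dist_eq, Real.dist_eq, zero_sub, abs_neg, abs_of_nonneg ht]
  have hmem : ∀ t : unitInterval, γ (t * dist z z') ∈ hypSegment z z' := fun t => by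
    have ht : (t : ℝ) * dist z z' ≤ dist z z' := mul_le_of_le_one_left hd0.le t.2.2
    have h2 : dist (γ (t * dist z z')) z' = dist z z' - t * dist z z' := by
      nth_rewrite 2 [← h1]
      rw [hγ.dist_eq, Real.dist_eq, abs_sub_comm, abs_of_nonneg (by linarith)]
    change _ + _ = _
    rw [hc, h2]; ring
  have hcont : Continuous fun t : unitInterval => γ (t * dist z z') :=
    hγ.continuous.comp (continuous_subtype_val.mul continuous_const)
  refine ⟨fun t => proj Γ (γ (t * dist z z')), ?_, ?_, fun t => ?_⟩
  · have hcp := (continuous_proj Γ).comp hcont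
    refine Topology.IsEmbedding.of_comp hcp hf.continuous ?_
    refine ((hf.continuous.comp hcp).isClosedEmbedding fun s t hst => ?_).isEmbedding
    obtain ⟨y, hy, hFy, hyd⟩ := hf.development.exists_side_point hT hij hz hz' hd (hmem s)
    obtain ⟨y', hy', hFy', hyd'⟩ := hf.development.exists_side_point hT hij hz hz' hd (hmem t)
    have hst' : f (proj Γ (γ (s * dist z z'))) = f (proj Γ (γ (t * dist z z'))) := hst
    have hyy : y = y' := (T.eq_of_sheet_eq hT ((mem_hypSegment_vertices_iff hT hij).1 hy).1
      ((mem_hypSegment_vertices_iff hT hij).1 hy').1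
      ((hFy true).symm.trans (hst'.trans (hFy' true)))).1
    rw [hyy, hyd', hc, hc] at hyd
    exact Subtype.ext (mul_right_cancel₀ hd0.ne' hyd.symm)
  · ext s
    constructor
    · rintro ⟨t, rfl⟩
      exact ⟨_, hmem t, rfl⟩
    · rintro ⟨w, hw, rfl⟩
      have hw' : dist z w + dist w z' = dist z z' := hw
      have ht : dist z w / dist z z' ∈ unitInterval :=
        ⟨by positivity, (div_le_one hd0).2 (by linarith [dist_nonneg (x := w) (y := z')])⟩
      refine ⟨⟨_, ht⟩, ?_⟩
      change proj Γ (γ (((⟨_, ht⟩ : unitInterval) : ℝ) * dist z z')) = _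
      congr 1
      apply eq_of_mem_hypSegment (hmem _) hw
      rw [hc]
      exact div_mul_cancel₀ _ hd0.ne'
  · rw [packingVertices_liftedCircles hf hT hn hΓ]
    change (∃ l, f (proj Γ (γ (t * dist z z'))) = T.conePt l) ↔ _
    have hiff := hf.development.conePt_iff_of_mem_side hT hij hz hz' hd (hmem t)
    rw [hiff]
    nth_rewrite 2 [← h0]
    nth_rewrite 3 [← h1]
    rw [hγ.injective.eq_iff, hγ.injective.eq_iff]
    constructor
    · rintro (h | h)
      · left
        exact Subtype.ext ((mul_eq_zero.1 h).resolve_right hd0.ne')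
      · right
        apply Subtype.ext
        exact mul_right_cancel₀ hd0.ne' (h.trans (one_mul _).symm)
    · rintro (rfl | rfl) <;> simp

include hf hT hn hΓ in
theorem edge_inter_liftedCircles {e e' : Set (Surface Γ)}
    (he : e ∈ packingEdges (liftedCircles f)) (he' : e' ∈ packingEdges (liftedCircles f))
    (hne : e ≠ e') : e ∩ e' ⊆ packingVertices (liftedCircles f) := by
  obtain ⟨i, j, hij, z, z', hz, hz', hd, rfl⟩ := (mem_packingEdges_liftedCircles hf hT hn hΓ).1 he
  obtain ⟨k, l, hkl, u, u', hu, hu', hud, rfl⟩ :=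
    (mem_packingEdges_liftedCircles hf hT hn hΓ).1 he'
  rintro s ⟨⟨w, hw, rfl⟩, w', hw', hww⟩
  rw [packingVertices_liftedCircles hf hT hn hΓ]
  by_contra hs
  have hs' : ∀ m, f (proj Γ w) ≠ T.conePt m := fun m hm => hs ⟨m, hm⟩
  apply hne
  obtain ⟨γ, hγ, rfl⟩ := proj_eq_proj_iff.1 hww.symm
  rw [← proj_image_hypSegment_smul hγ u u']
  have hw'' : γ • w' ∈ hypSegment (γ • u) (γ • u') := by
    simpa only [hypSegment, Set.mem_ofPred_eq, dist_smul] using hw'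
  rw [← proj_smul hγ] at hu hu'
  rw [← dist_smul γ] at hud
  obtain ⟨y, hy, hFy, hyd⟩ := hf.development.exists_side_point hT hij hz hz' hd hw
  obtain ⟨y', hy', hFy', hyd'⟩ := hf.development.exists_side_point hT hkl hu hu' hud hw''
  have hy1 := (mem_hypSegment_vertices_iff hT hij).1 hy
  have hy2 := (mem_hypSegment_vertices_iff hT hkl).1 hy'
  have hyy : y = y' := (T.eq_of_sheet_eq hT hy1.1 hy2.1 ((hFy true).symm.trans (hFy' true))).1
  subst hyy
  -- a point of two different sides of the triangle is a vertex
  have hsame : (k = i ∧ l = j) ∨ (k = j ∧ l = i) := by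
    by_contra hn'
    have hcomb : ∀ i j k l : Fin 3, i ≠ j → k ≠ l → ¬((k = i ∧ l = j) ∨ (k = j ∧ l = i)) →
        ∃ m, ∀ n, n ≠ m → (n ≠ i ∧ n ≠ j) ∨ (n ≠ k ∧ n ≠ l) := by decide
    obtain ⟨m, hm⟩ := hcomb i j k l hij hkl hn'
    apply hs' m
    rw [hFy true, eq_vertex_of_bary hT hy1.1 (j := m) fun n hnm => ?_, T.sheet_pt hT]
    rcases hm n hnm with h | h
    · exact hy1.2 n h.1 h.2
    · exact hy2.2 n h.1 h.2
  rcases hsame with ⟨rfl, rfl⟩ | ⟨rfl, rfl⟩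
  · rw [hf.development.eq_of_mem_sides hT hij hz hz' hd hu hu' hud hw hw'' hs',
      hf.development.eq_of_mem_sides hT hij.symm hz' hz (by rw [dist_comm, hd, dist_comm]) hu' hu
        (by rw [dist_comm, hud, dist_comm]) (by rwa [hypSegment_comm])
        (by rwa [hypSegment_comm]) hs']
  · rw [hypSegment_comm (γ • u),
      hf.development.eq_of_mem_sides hT hij hz hz' hd hu' hu
        (by rw [dist_comm, hud, dist_comm]) hw (by rwa [hypSegment_comm]) hs',
      hf.development.eq_of_mem_sides hT hij.symm hz' hz (by rw [dist_comm, hd, dist_comm]) hu hu'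
        hud (by rwa [hypSegment_comm]) hw'' hs']

include hf hT hn hΓ in
/-- Edges have bounded length and endpoints in the discrete preimage of the cone points, so that only
finitely many of them come near a given point. -/
theorem locally_finite_liftedCircles (x : Surface Γ) :
    ∃ U ∈ nhds x, (packingVertices (liftedCircles f) ∩ U).Finite ∧
      {e ∈ packingEdges (liftedCircles f) | (e ∩ U).Nonempty}.Finite := by
  obtain ⟨z, rfl⟩ := proj_surjective Γ x
  have hV : ∀ R, {w | (∃ i, f (proj Γ w) = T.conePt i) ∧ dist w z ≤ R}.Finite := by
    intro R
    have : {w | (∃ i, f (proj Γ w) = T.conePt i) ∧ dist w z ≤ R} =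
        ⋃ i, (fun w => f (proj Γ w)) ⁻¹' {T.conePt i} ∩ Metric.closedBall z R := by
      ext w; simp
    rw [this]
    exact Set.finite_iUnion fun i => hf.development.finite_fiber_inter_closedBall hn _ z R
  refine ⟨proj Γ '' Metric.ball z 1, ((isOpenMap_proj Γ) _ Metric.isOpen_ball).mem_nhds
    ⟨z, Metric.mem_ball_self one_pos, rfl⟩, ?_, ?_⟩
  · rw [packingVertices_liftedCircles hf hT hn hΓ]
    refine ((hV 1).image (proj Γ)).subset ?_
    rintro s ⟨hs, w, hw, rfl⟩
    exact ⟨w, ⟨hs, (Metric.mem_ball.1 hw).le⟩, rfl⟩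
  · set D := ∑ i, ∑ j, dist (T.pt i) (T.pt j) with hD
    have hle : ∀ i j, dist (T.pt i) (T.pt j) ≤ D := fun i j =>
      (Finset.single_le_sum (f := fun j => dist (T.pt i) (T.pt j)) (fun _ _ => dist_nonneg)
        (Finset.mem_univ j)).trans
      (Finset.single_le_sum (f := fun i => ∑ j, dist (T.pt i) (T.pt j))
        (fun _ _ => Finset.sum_nonneg fun _ _ => dist_nonneg) (Finset.mem_univ i))
    refine (((hV (1 + D)).prod (hV (1 + D))).image
      fun P => proj Γ '' hypSegment P.1 P.2).subset ?_
    rintro e ⟨he, s, hse, w, hw, rfl⟩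
    obtain ⟨i, j, hij, u, u', hu, hu', hd, rfl⟩ :=
      (mem_packingEdges_liftedCircles hf hT hn hΓ).1 he
    obtain ⟨v, hv, hvw⟩ := hse
    obtain ⟨γ, hγ, rfl⟩ := proj_eq_proj_iff.1 hvw.symm
    rw [Metric.mem_ball] at hw
    have hv' : dist u v + dist v u' = dist u u' := hv
    have hb := hle i j
    have h1 := dist_nonneg (x := u) (y := v)
    have h2 := dist_nonneg (x := v) (y := u')
    refine ⟨(γ • u, γ • u'), ⟨⟨⟨i, by rw [proj_smul hγ, hu]⟩, ?_⟩,
      ⟨⟨j, by rw [proj_smul hγ, hu']⟩, ?_⟩⟩, proj_image_hypSegment_smul hγ u u'⟩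
    · have h3 := dist_triangle (γ • u) (γ • v) z
      rw [dist_smul] at h3
      change dist (γ • u) z ≤ 1 + D
      linarith
    · have h3 := dist_triangle (γ • u') (γ • v) z
      rw [dist_smul, dist_comm u'] at h3
      change dist (γ • u') z ≤ 1 + D
      linarith

include hf hT hn hΓ in
/-- The complement of the packing graph consists of the points over the open sheets. -/
theorem mem_compl_graph_iff {w : ℍ} :
    proj Γ w ∈ (packingVertices (liftedCircles f) ∪ ⋃₀ packingEdges (liftedCircles f))ᶜ ↔
      ∃ b, ∃ y ∈ openTri hT, f (proj Γ w) = T.sheet b y := by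
  rw [packingVertices_liftedCircles hf hT hn hΓ]
  constructor
  · intro hw
    obtain ⟨b, y, hy, hb⟩ := T.exists_sheet_eq hT (f (proj Γ w))
    refine ⟨b, y, fun k => lt_of_le_of_ne (hy k) fun hk => hw ?_, hb.symm⟩
    right
    obtain ⟨g, hg, hgy⟩ := hf.development.exists_lift hT hn hy hb.symm
    obtain ⟨i, j, hij, -, -, hall⟩ := exists_opposite_side k
    have hseg : y ∈ hypSegment (T.pt i) (T.pt j) :=
      (mem_hypSegment_vertices_iff hT hij).2 ⟨hy, fun l h1 h2 => by rw [hall l h1 h2, ← hk]⟩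
    refine ⟨proj Γ '' hypSegment (g (T.pt i)) (g (T.pt j)),
      (mem_packingEdges_liftedCircles hf hT hn hΓ).2 ⟨i, j, hij, _, _, ?_, ?_, ?_, rfl⟩, w, ?_, rfl⟩
    · exact (hg _ (vertex_mem_closedTri hT i)).trans (T.sheet_pt hT b i)
    · exact (hg _ (vertex_mem_closedTri hT j)).trans (T.sheet_pt hT b j)
    · exact g.isometry.dist_eq _ _
    · rw [← image_hypSegment]
      exact ⟨y, hseg, hgy⟩
  · rintro ⟨b, y, hy, hb⟩ (⟨i, hi⟩ | ⟨e, he, hwe⟩)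
    · exact T.sheet_ne_conePt_of_mem_openTri hT hy i (hb.symm.trans hi)
    · obtain ⟨i, j, hij, z, z', hz, hz', hd, rfl⟩ :=
        (mem_packingEdges_liftedCircles hf hT hn hΓ).1 he
      obtain ⟨v, hv, hvw⟩ := hwe
      obtain ⟨y', hy', hFy', -⟩ := hf.development.exists_side_point hT hij hz hz' hd hv
      have hy2 := (mem_hypSegment_vertices_iff hT hij).1 hy'
      obtain rfl := (T.eq_of_sheet_eq hT (openTri_subset_closedTri hT hy) hy2.1
        (hb.symm.trans ((congrArg f hvw).symm.trans (hFy' true)))).1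
      obtain ⟨k, hki, hkj⟩ := exists_third i j
      exact (hy k).ne' (hy2.2 k hki hkj)

include hf hT hn hΓ in
/-- The components of the complement of the packing graph are the projections of the lifts of the
open sheets: these are open, and any two of them are equal or disjoint. -/
theorem connectedComponentIn_compl_graph {b : Bool} {g : ℍ ≃ᵢ ℍ}
    (hg : IsLift (fun z => f (proj Γ z)) hT b g) {x : Surface Γ}
    (hx : x ∈ proj Γ '' (g '' openTri hT)) :
    connectedComponentIn
      (packingVertices (liftedCircles f) ∪ ⋃₀ packingEdges (liftedCircles f))ᶜ x =
      proj Γ '' (g '' openTri hT) := by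
  have hopen : ∀ g : ℍ ≃ᵢ ℍ, IsOpen (proj Γ '' (g '' openTri hT)) := fun g =>
    isOpenMap_proj Γ _ (g.toHomeomorph.isOpenMap _ (isOpen_openTri hT))
  have hsub : ∀ (b : Bool) (g : ℍ ≃ᵢ ℍ), IsLift (fun z => f (proj Γ z)) hT b g →
      proj Γ '' (g '' openTri hT) ⊆
        (packingVertices (liftedCircles f) ∪ ⋃₀ packingEdges (liftedCircles f))ᶜ := by
    rintro b g hg s ⟨_, ⟨y, hy, rfl⟩, rfl⟩
    exact (mem_compl_graph_iff hf hT hn hΓ).2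
      ⟨b, y, hy, hg y (openTri_subset_closedTri hT hy)⟩
  apply Set.Subset.antisymm
  · set W' : Set (Surface Γ) := ⋃₀ {W | Disjoint (proj Γ '' (g '' openTri hT)) W ∧
      ∃ g' : ℍ ≃ᵢ ℍ, W = proj Γ '' (g' '' openTri hT)} with hW'
    have hW'o : IsOpen W' := by
      apply isOpen_sUnion
      rintro W ⟨-, g', rfl⟩
      exact hopen g'
    have hdisj : Disjoint (proj Γ '' (g '' openTri hT)) W' :=
      Set.disjoint_sUnion_right.2 fun W hW => hW.1
    refine isPreconnected_connectedComponentIn.subset_left_of_subset_union (hopen g) hW'o hdisj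
      ?_ ⟨x, mem_connectedComponentIn (hsub b g hg hx), hx⟩
    intro s hs
    have hs := connectedComponentIn_subset _ _ hs
    obtain ⟨w, rfl⟩ := proj_surjective Γ s
    obtain ⟨b', y, hy, hb'⟩ := (mem_compl_graph_iff hf hT hn hΓ).1 hs
    obtain ⟨g', hg', hgy⟩ := hf.development.exists_lift_of_mem_openTri hT hy hb'
    by_cases hd : Disjoint (proj Γ '' (g '' openTri hT)) (proj Γ '' (g' '' openTri hT))
    · exact .inr ⟨_, ⟨hd, g', rfl⟩, w, ⟨y, hy, hgy⟩, rfl⟩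
    · left
      rw [Set.not_disjoint_iff] at hd
      obtain ⟨_, ⟨_, ⟨c, hc, rfl⟩, rfl⟩, _, ⟨c', hc', rfl⟩, hcc⟩ := hd
      have hcT := openTri_subset_closedTri hT hc
      have hcT' := openTri_subset_closedTri hT hc'
      have hF : T.sheet b c = T.sheet b' c' := by
        rw [← hg c hcT, ← hg' c' hcT']
        exact (congrArg f hcc).symm
      obtain ⟨rfl, rfl | ⟨k, hk⟩⟩ := T.eq_of_sheet_eq hT hcT hcT' hF
      · obtain ⟨γ, hγ, hgc⟩ := proj_eq_proj_iff.1 hcc.symm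
        have hlift : IsLift (fun z => f (proj Γ z)) hT b
            (g'.trans (IsometryEquiv.constSMul γ)) := by
          intro v hv
          rw [← hg' v hv]
          change f (proj Γ (γ • g' v)) = f (proj Γ (g' v))
          rw [proj_smul hγ]
        have heq := hf.development.isLift_unique hT hlift hg hc hgc
        rw [← heq]
        refine ⟨_, ⟨y, hy, rfl⟩, ?_⟩
        change proj Γ (γ • g' y) = proj Γ w
        rw [proj_smul hγ, hgy]
      · exact absurd hk (hc k).ne'
  · apply IsPreconnected.subset_connectedComponentIn _ hx (hsub b g hg)
    rw [Set.image_image]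
    exact (isPreconnected_openTri hT).image _
      ((continuous_proj Γ).comp g.continuous).continuousOn

include hf hT hn hΓ in
theorem face_liftedCircles {x : Surface Γ}
    (hx : x ∈ (packingVertices (liftedCircles f) ∪ ⋃₀ packingEdges (liftedCircles f))ᶜ) :
    ∃ σ : stdSimplex ℝ (Fin 3) → Surface Γ, Topology.IsEmbedding σ ∧
      σ '' {t | ∀ i, 0 < t i} = connectedComponentIn
        (packingVertices (liftedCircles f) ∪ ⋃₀ packingEdges (liftedCircles f))ᶜ x ∧
      (∀ t : stdSimplex ℝ (Fin 3), (∃ i, t i = 1) → σ t ∈ packingVertices (liftedCircles f)) ∧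
      ∀ i : Fin 3, σ '' {t | t i = 0} ∈ packingEdges (liftedCircles f) := by
  obtain ⟨w, rfl⟩ := proj_surjective Γ x
  obtain ⟨b, y, hy, hb⟩ := (mem_compl_graph_iff hf hT hn hΓ).1 hx
  obtain ⟨g, hg, hgy⟩ := hf.development.exists_lift_of_mem_openTri hT hy hb
  have hv : ∀ i, f (proj Γ (g (T.pt i))) = T.conePt i := fun i =>
    (hg _ (vertex_mem_closedTri hT i)).trans (T.sheet_pt hT b i)
  refine ⟨fun t => proj Γ (g (simplexMap T.pt t)), ?_, ?_, ?_, ?_⟩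
  · have hc : Continuous fun t => proj Γ (g (simplexMap T.pt t)) :=
      (continuous_proj Γ).comp (g.continuous.comp (continuous_simplexMap T.pt))
    refine Topology.IsEmbedding.of_comp hc hf.continuous ?_
    refine ((hf.continuous.comp hc).isClosedEmbedding fun s t hst => ?_).isEmbedding
    have hs := hg _ (simplexMap_mem_closedTri hT s)
    have ht := hg _ (simplexMap_mem_closedTri hT t)
    apply simplexMap_injective hT
    exact (T.eq_of_sheet_eq hT (simplexMap_mem_closedTri hT s) (simplexMap_mem_closedTri hT t)
      (hs.symm.trans (hst.trans ht))).1
  · rw [connectedComponentIn_compl_graph hf hT hn hΓ hg ⟨w, ⟨y, hy, hgy⟩, rfl⟩,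
      ← simplexMap_image_interior hT, Set.image_image, Set.image_image]
  · rintro t ⟨i, hi⟩
    rw [packingVertices_liftedCircles hf hT hn hΓ]
    refine ⟨i, ?_⟩
    change f (proj Γ (g (simplexMap T.pt t))) = T.conePt i
    rw [simplexMap_vertex hT hi, hv]
  · intro k
    obtain ⟨i, j, hij, hki, hkj, -⟩ := exists_opposite_side k
    rw [mem_packingEdges_liftedCircles hf hT hn hΓ]
    refine ⟨i, j, hij, g (T.pt i), g (T.pt j), hv i, hv j, g.isometry.dist_eq _ _, ?_⟩
    rw [← image_hypSegment, ← simplexMap_image_side hT hij hki hkj, Set.image_image,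
      Set.image_image]

end Triangulation

end CirclePacking

theorem lemma1 (Γ : Subgroup CirclePacking.PSL2R) (hΓ : CirclePacking.IsClosedHyperbolic Γ)
    (p q r : ℕ) (hp : 2 ≤ p) (hq : 2 ≤ q) (hr : 2 ≤ r)
    (hpqr : (1 / p + 1 / q + 1 / r : ℝ) < 1)
    (hcover : CirclePacking.CoversTurnover Γ p q r) :
    CirclePacking.Packable Γ := by
  obtain ⟨T, f, hf⟩ := hcover
  have hT := T.linearIndependent_pt hp
  have hn := T.coneOrder_ne_zero hp hq hr
  exact ⟨CirclePacking.liftedCircles f,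
    fun c hc c' hc' hne => CirclePacking.disjoint_interior_liftedCircles hf hT hn hc hc' hne,
    { edge_arc := fun e he => CirclePacking.edge_arc_liftedCircles hf hT hn hΓ.torsionFree he
      edge_inter := fun e he e' he' hne =>
        CirclePacking.edge_inter_liftedCircles hf hT hn hΓ.torsionFree he he' hne
      locally_finite := CirclePacking.locally_finite_liftedCircles hf hT hn hΓ.torsionFree
      face := fun x hx => CirclePacking.face_liftedCircles hf hT hn hΓ.torsionFree hx }⟩
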